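/- Let $G$ be a finite group, and let $\hat G$ be a set of representatives of the unitary equivalence classes of irreducible unitary representations of $G$, containing the trivial representation $\mathbf 1$. For $\pi\in\hat G$ let $d\pi=\dim H_\pi$ and fix an orthonormal basis of $H_\pi$. For $\pi,\rho,\sigma\in\hat G$ let $(\sigma,\pi\otimes\rho)$ be the space of intertwiners $H_\sigma\to H_\pi\otimes H_\rho$, with the inner product $\langle T,S\rangle 1=S^*T$, and fix an orthonormal basis $\{T_{\pi,\rho}^{\sigma,e}\}_e$ of it, with matrix entries $T_{\pi_i,\rho_k}^{\sigma_m,e}$. Let $M$ be a factor of type II$_1$. An action of $\hat G$ on $M$ is a family $\alpha=\{\alpha_\pi\}_{\pi\in\hat G}$ of unital $*$-homomorphisms $\alpha_\pi:M\to M\otimes B(H_\pi)$ with $\alpha_{\mathbf 1}=\mathrm{id}_M$ and $(\alpha_\pi\otimes\mathrm{id}_\rho)(\alpha_\rho(x))\,T=T\,\alpha_\sigma(x)$ for all $x\in M$ and $T\in(\sigma,\pi\otimes\rho)$. It is outer if for $\pi\neq\mathbf 1$ the only $a\in M\otimes B(H_\pi)$ with $\alpha_\pi(x)a=a(x\otimes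 1_\pi)$ for all $x\in M$ is $a=0$. A system of matrix units for $B(\ell^2(\hat G))$ in $M$, where $\ell^2(\hat G)=\bigoplus_{\pi\in\hat G}B(H_\pi)$, is a family $E=\{e_{\pi_{ij},\rho_{kl}}\}\subset M$, with $\pi,\rho\in\hat G$, $1\le i,j\le d\pi$, $1\le k,l\le d\rho$, such that $e_{a,b}e_{c,d}=\delta_{b,c}e_{a,d}$, $e_{a,b}^*=e_{b,a}$ and $\sum_a e_{a,a}=1$. For such $E$ let $\lambda_\pi^E=(\lambda^E_{\pi_{ij}})_{i,j}\in M\otimes B(H_\pi)$ be given by $$\lambda^E_{\pi_{ij}}=\sum_{\rho,k,l,\sigma,m,n,e}\sqrt{\frac{d\rho}{d\sigma}}\;T_{\pi_i,\rho_k}^{\sigma_m,e}\,\overline{T_{\pi_j,\rho_l}^{\sigma_n,e}}\;e_{\sigma_{mn},\rho_{kl}}.$$ Then, for every outer action $\alpha$ of $\hat G$ on $M$, there is a system $E$ of matrix units for $B(\ell^2(\hat G))$ in $M$ which is $\alpha$-equivariant, that is, $\alpha_\pi(x)=\lambda_\pi^E(x\otimes 1_\pi)(\lambda_\pi^E)^*$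 for all $\pi\in\hat G$ and $x\in E$. -/

import Mathlib

open scoped Matrix Kronecker

noncomputable section

/-! ### Unitary representations of a group and the dual -/

/-- A finite dimensional unitary representation of `G`, written in a fixed orthonormal basis
`e₁, …, e_d` of its Hilbert space, so that `B(H_π)` is the algebra of `d × d` matrices. -/
structure UnitaryRep (G : Type*) [Group G] where
  /-- the dimension `dπ` -/
  dim : ℕ
  /-- the unitary matrices `π(g)` -/
  mat : G →* Matrix.unitaryGroup (Fin dim) ℂ

namespace UnitaryRep

variable {G : Type*} [Group G]

/-- The underlying linear representation. -/
def toRepresentation (π : UnitaryRep G) : Representation ℂ G (Fin π.dim → ℂ) :=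
  ((Matrix.toLinAlgEquiv' (R := ℂ) (n := Fin π.dim)).toAlgHom.toRingHom.toMonoidHom).comp
    ((Matrix.unitaryGroup (Fin π.dim) ℂ).subtype.comp π.mat)

/-- Irreducibility. -/
def IsIrred (π : UnitaryRep G) : Prop := π.toRepresentation.IsIrreducible

/-- Unitary equivalence. -/
def UnitarilyEquiv (π ρ : UnitaryRep G) : Prop :=
  ∃ U : Matrix (Fin ρ.dim) (Fin π.dim) ℂ, Uᴴ * U = 1 ∧ U * Uᴴ = 1 ∧
    ∀ g, U * (π.mat g : Matrix (Fin π.dim) (Fin π.dim) ℂ) =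
      (ρ.mat g : Matrix (Fin ρ.dim) (Fin ρ.dim) ℂ) * U

/-- The intertwiner space `(σ, π ⊗ ρ) ⊆ B(H_σ, H_π ⊗ H_ρ)`. -/
def intertwiners (σ π ρ : UnitaryRep G) :
    Submodule ℂ (Matrix (Fin π.dim × Fin ρ.dim) (Fin σ.dim) ℂ) where
  carrier := {T | ∀ g, T * (σ.mat g : Matrix (Fin σ.dim) (Fin σ.dim) ℂ) =
    ((π.mat g : Matrix (Fin π.dim) (Fin π.dim) ℂ) ⊗ₖ
      (ρ.mat g : Matrix (Fin ρ.dim) (Fin ρ.dim) ℂ)) * T}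
  add_mem' := by
    intro a b ha hb g
    rw [Matrix.add_mul, Matrix.mul_add, ha g, hb g]
  zero_mem' := by
    intro g
    simp
  smul_mem' := by
    intro c T hT g
    rw [Matrix.smul_mul, Matrix.mul_smul, hT g]

end UnitaryRep

/-- A choice `Ĝ` of representatives of the unitary equivalence classes of irreducible unitary
representations of `G`, indexed by `Γ` and containing the trivial representation. -/
structure UnitaryDual (G : Type*) [Group G] (Γ : Type*) where
  /-- the representation with a given index -/
  rep : Γ → UnitaryRep G
  irred : ∀ π, (rep π).IsIrred
  eq_of_equiv : ∀ π ρ, (rep π).UnitarilyEquiv (rep ρ) → π = ρ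
  exists_equiv : ∀ θ : UnitaryRep G, θ.IsIrred → ∃ π, θ.UnitarilyEquiv (rep π)
  /-- the index of the trivial representation -/
  triv : Γ
  dim_triv : (rep triv).dim = 1
  mat_triv : ∀ g, (rep triv).mat g = 1

namespace UnitaryDual

variable {G : Type*} [Group G] {Γ : Type*}

/-- The dimension `dπ`. -/
abbrev d (D : UnitaryDual G Γ) (π : Γ) : ℕ := (D.rep π).dim

/-- The index set `{π_{ij}}` of the standard basis of
`ℓ²(Ĝ) = ⨁_π B(H_π)`; it has `∑_π (dπ)² = |G|` elements. -/
abbrev Idx (D : UnitaryDual G Γ) : Type _ := Σ π : Γ, Fin (D.d π) × Fin (D.d π)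

/-- A choice, for all `π, ρ, σ ∈ Ĝ`, of an orthonormal basis `(T_{π,ρ}^{σ,e})_e` of the Hilbert
space `(σ, π ⊗ ρ)`, whose inner product is given by `⟨T, S⟩ 1 = S* T`. -/
structure IntertwinerBasis (D : UnitaryDual G Γ) where
  /-- the multiplicity of `σ` in `π ⊗ ρ` -/
  N : Γ → Γ → Γ → ℕ
  /-- the basis vectors -/
  T : ∀ π ρ σ : Γ, Fin (N π ρ σ) → Matrix (Fin (D.d π) × Fin (D.d ρ)) (Fin (D.d σ)) ℂ
  orthonormal : ∀ π ρ σ e f, (T π ρ σ e)ᴴ * T π ρ σ f = if e = f then 1 else 0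
  span_eq : ∀ π ρ σ, Submodule.span ℂ (Set.range (T π ρ σ)) =
    UnitaryRep.intertwiners (D.rep σ) (D.rep π) (D.rep ρ)

end UnitaryDual

/-! ### Factors of type II₁ -/

section VN

variable {H : Type*} [NormedAddCommGroup H] [InnerProductSpace ℂ H] [CompleteSpace H]

/-- The *-algebra of elements of a von Neumann algebra. -/
abbrev VonNeumannAlgebra.Elem (M : VonNeumannAlgebra H) : Type _ := M.toStarSubalgebra

/-- `M` is a factor: its centre is `ℂ 1`. -/
def VonNeumannAlgebra.IsFactor (M : VonNeumannAlgebra H) : Prop :=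
  ∀ x ∈ M, x ∈ M.commutant → ∃ c : ℂ, x = c • (1 : H →L[ℂ] H)

/-- `τ` is a faithful normal tracial state on `M`. Normality is ultraweak continuity. -/
structure VonNeumannAlgebra.IsFaithfulNormalTrace (M : VonNeumannAlgebra H)
    (τ : M.Elem →ₗ[ℂ] ℂ) : Prop where
  map_one : τ 1 = 1
  nonneg : ∀ x : M.Elem, 0 ≤ (τ (star x * x)).re ∧ (τ (star x * x)).im = 0
  faithful : ∀ x : M.Elem, τ (star x * x) = 0 → x = 0
  tracial : ∀ x y : M.Elem, τ (x * y) = τ (y * x)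
  normal : ∃ ξ η : ℕ → H, Summable (fun n => ‖ξ n‖ ^ 2) ∧ Summable (fun n => ‖η n‖ ^ 2) ∧
    ∀ x : M.Elem, HasSum (fun n => inner ℂ (η n) ((x : H →L[ℂ] H) (ξ n))) (τ x)

/-- `M` is a factor of type II₁: an infinite dimensional factor with a faithful normal tracial
state. -/
structure VonNeumannAlgebra.IsTypeIIOneFactor (M : VonNeumannAlgebra H) : Prop where
  isFactor : M.IsFactor
  infinite_dimensional : ¬ FiniteDimensional ℂ M.Elem
  exists_trace : ∃ τ : M.Elem →ₗ[ℂ] ℂ, M.IsFaithfulNormalTrace τ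

end VN

/-! ### Actions of the dual and equivariant matrix units

Below `A` is the *-algebra of elements of a von Neumann algebra, and `A ⊗ B(H_π)` is the
*-algebra of `dπ × dπ` matrices over `A`. -/

namespace UnitaryDual

variable {G : Type*} [Group G] {Γ : Type*}
variable {A : Type*} [Ring A] [StarRing A] [Algebra ℂ A]

/-- `α = (α_π)_{π ∈ Ĝ}`, with `α_π : A → A ⊗ B(H_π)` unital *-homomorphisms, is an action of `Ĝ`:
`α_1 = id`, and `(α_π ⊗ id_ρ)(α_ρ(x)) T = T α_σ(x)` for all `T ∈ (σ, π ⊗ ρ)`. -/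
structure IsAction (D : UnitaryDual G Γ)
    (α : ∀ π : Γ, A →⋆ₐ[ℂ] Matrix (Fin (D.d π)) (Fin (D.d π)) A) : Prop where
  triv : ∀ x, α D.triv x = Matrix.scalar _ x
  intertwine : ∀ (π ρ σ : Γ) (T : Matrix (Fin (D.d π) × Fin (D.d ρ)) (Fin (D.d σ)) ℂ),
    T ∈ UnitaryRep.intertwiners (D.rep σ) (D.rep π) (D.rep ρ) → ∀ x : A,
      (Matrix.of fun p q : Fin (D.d π) × Fin (D.d ρ) => α π (α ρ x p.2 q.2) p.1 q.1) *
          T.map (algebraMap ℂ A) =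
        T.map (algebraMap ℂ A) * α σ x

/-- The action `α` is free (outer, if `A` is a factor): for `π ≠ 1` there is no nonzero
`a ∈ A ⊗ B(H_π)` with `α_π(x) a = a (x ⊗ 1)` for all `x`. -/
def IsOuter (D : UnitaryDual G Γ)
    (α : ∀ π : Γ, A →⋆ₐ[ℂ] Matrix (Fin (D.d π)) (Fin (D.d π)) A) : Prop :=
  ∀ π : Γ, π ≠ D.triv → ∀ a : Matrix (Fin (D.d π)) (Fin (D.d π)) A,
    (∀ x : A, α π x * a = a * Matrix.scalar _ x) → a = 0

/-- `E = (e_{π_{ij}, ρ_{kl}})` is a system of matrix units for `B(ℓ²(Ĝ))` in `A`. -/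
structure IsMatrixUnits [Fintype Γ] [DecidableEq Γ] (D : UnitaryDual G Γ)
    (E : D.Idx → D.Idx → A) : Prop where
  mul : ∀ a b c d, E a b * E c d = if b = c then E a d else 0
  star : ∀ a b, star (E a b) = E b a
  sum : ∑ a, E a a = 1

/-- The representation `λ_π^E` of `Ĝ` associated with `E`, an element of `A ⊗ B(H_π)`:
`λ_{π_{ij}} = ∑ √(dρ/dσ) T_{π_i,ρ_k}^{σ_m,e} conj(T_{π_j,ρ_l}^{σ_n,e}) e_{σ_{mn},ρ_{kl}}`,
summed over `ρ, k, l, σ, m, n, e`. -/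
def lambdaE [Fintype Γ] (D : UnitaryDual G Γ) (B : D.IntertwinerBasis)
    (E : D.Idx → D.Idx → A) (π : Γ) : Matrix (Fin (D.d π)) (Fin (D.d π)) A :=
  Matrix.of fun i j =>
    ∑ ρ : Γ, ∑ k : Fin (D.d ρ), ∑ l : Fin (D.d ρ),
      ∑ σ : Γ, ∑ m : Fin (D.d σ), ∑ n : Fin (D.d σ), ∑ e : Fin (B.N π ρ σ),
        (((Real.sqrt ((D.d ρ : ℝ) / (D.d σ : ℝ)) : ℝ) : ℂ) *
          B.T π ρ σ e (i, k) m * starRingEnd ℂ (B.T π ρ σ e (j, l) n)) •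
            E ⟨σ, (m, n)⟩ ⟨ρ, (k, l)⟩

/-- `E` is `α`-equivariant: `α_π(x) = Ad λ_π^E (x ⊗ 1)` for `x ∈ E`. -/
def IsEquivariant [Fintype Γ] (D : UnitaryDual G Γ) (B : D.IntertwinerBasis)
    (α : ∀ π : Γ, A →⋆ₐ[ℂ] Matrix (Fin (D.d π)) (Fin (D.d π)) A)
    (E : D.Idx → D.Idx → A) : Prop :=
  ∀ (π : Γ) (a b : D.Idx),
    α π (E a b) = D.lambdaE B E π * Matrix.scalar _ (E a b) * star (D.lambdaE B E π)

end UnitaryDual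

end

/-! Fourier inversion on the finite group turns an action of the dual into a grading: writing
`α_π(x) = ∑_g π(g) ⊗ c_g(x)` defines components `c_g(x)`, and the axioms of an action make `c_g` the
projection onto the summand `A_g` of a decomposition `A = ⨁ A_g` with `A_g A_h ⊆ A_{gh}` and `A_g* =
A_{g⁻¹}` (`IsAction.isStarGrading`).

Suppose there are `v_g ∈ A_g` with `v_g* v_h = δ_{g,h} v_1` and `∑ v_g v_g* = 1`. The elements `v_g
v_h*` are then matrix units over `G`, homogeneous of degree `gh⁻¹`, so `α_π` multiplies them by
`π(gh⁻¹) = π(g) π(h)*`, which is what conjugation by `∑_g π(g) ⊗ v_g v_g*` does. The unitary Fourier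
matrix changes the index set from `G` to the matrix coefficients, and after this change of basis
that unitary is precisely `λ_π^E` (`lambdaE_fourierFamily`, `isEquivariant_of_isTower`).

It remains to find such a full tower. Outerness gives `f A_g e ≠ 0` for all nonzero `e`, `f` and
every `g` (`exists_mul_mul_ne_zero`). A minimal projection of `A_1` would force `A` to be finite
dimensional (`exists_lt_proj`), so there is room to fit small partial isometries of every degree
with orthogonal ranges under any nonzero projection of `A_1` (`exists_tower_le`). A maximal
orthogonal family of towers, summed by means of the trace and polar decomposition
(`exists_sum_towers`), is full. -/

noncomputable section

/-! ### Representation theory of a finite group -/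

namespace UnitaryRep

variable {G : Type*} [Group G]

/-- The matrix `π(g)`. -/
abbrev val (π : UnitaryRep G) (g : G) : Matrix (Fin π.dim) (Fin π.dim) ℂ := π.mat g

lemma val_mul (π : UnitaryRep G) (g h : G) : π.val (g * h) = π.val g * π.val h := by
  simp [val]

lemma val_one (π : UnitaryRep G) : π.val 1 = 1 := by simp [val]

lemma conjTranspose_mul_val (π : UnitaryRep G) (g : G) : (π.val g)ᴴ * π.val g = 1 :=
  Matrix.mem_unitaryGroup_iff'.1 (π.mat g).2

lemma val_mul_conjTranspose (π : UnitaryRep G) (g : G) : π.val g * (π.val g)ᴴ = 1 :=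
  Matrix.mem_unitaryGroup_iff.1 (π.mat g).2

lemma val_inv (π : UnitaryRep G) (g : G) : π.val g⁻¹ = (π.val g)ᴴ := by
  rw [← one_mul (π.val g)ᴴ, ← π.val_one, ← inv_mul_cancel g, val_mul, Matrix.mul_assoc,
    val_mul_conjTranspose, mul_one]

lemma toRepresentation_apply (π : UnitaryRep G) (g : G) (v : Fin π.dim → ℂ) :
    π.toRepresentation g v = π.val g *ᵥ v := rfl

lemma IsIrred.dim_pos {π : UnitaryRep G} (h : π.IsIrred) : 0 < π.dim := by
  by_contra h0
  have h1 : IsEmpty (Fin π.dim) := by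
    rw [Nat.eq_zero_of_not_pos h0]; infer_instance
  have h2 : IsSimpleOrder (Subrepresentation π.toRepresentation) := h
  obtain ⟨x, y, hxy⟩ := h2.toNontrivial
  exact hxy (Subrepresentation.toSubmodule_injective (Subsingleton.elim _ _))

/-- Schur's lemma for the endomorphisms of an irreducible representation. -/
lemma IsIrred.eq_smul_one {π : UnitaryRep G} (h : π.IsIrred)
    (X : Matrix (Fin π.dim) (Fin π.dim) ℂ) (hX : ∀ g, X * π.val g = π.val g * X) :
    ∃ c : ℂ, X = c • (1 : Matrix (Fin π.dim) (Fin π.dim) ℂ) := by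
  have h2 : π.toRepresentation.IsIrreducible := h
  let f : Representation.IntertwiningMap π.toRepresentation π.toRepresentation :=
    (Matrix.toLin' X).intertwiningMap_of_isIntertwiningMap _ _ (by
      intro g v
      simp only [toRepresentation_apply, Matrix.toLin'_apply, Matrix.mulVec_mulVec, hX])
  obtain ⟨c, hc⟩ :=
    (Representation.IsIrreducible.algebraMap_intertwiningMap_bijective_of_isAlgClosed
      (ρ := π.toRepresentation)).2 f
  refine ⟨c, ?_⟩
  apply Matrix.toLin'.injective
  ext1 v
  have := congrArg (fun F : Representation.IntertwiningMap π.toRepresentation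
    π.toRepresentation => F.toLinearMap) hc
  have h3 : Matrix.toLin' X = c • LinearMap.id := this.symm
  rw [h3]
  simp

open ComplexOrder in
/-- Schur's lemma for inequivalent irreducible representations. -/
lemma IsIrred.eq_zero_of_not_equiv {π ρ : UnitaryRep G} (hπ : π.IsIrred) (hρ : ρ.IsIrred)
    (hne : ¬ ρ.UnitarilyEquiv π)
    (X : Matrix (Fin π.dim) (Fin ρ.dim) ℂ) (hX : ∀ g, X * ρ.val g = π.val g * X) : X = 0 := by
  by_contra hX0
  have hX' : ∀ g, Xᴴ * π.val g = ρ.val g * Xᴴ := by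
    intro g
    have := congrArg Matrix.conjTranspose (hX g⁻¹)
    simpa only [Matrix.conjTranspose_mul, val_inv, Matrix.conjTranspose_conjTranspose] using
      this.symm
  obtain ⟨c, hc⟩ := hρ.eq_smul_one (Xᴴ * X) (fun g => by
    rw [Matrix.mul_assoc, hX, ← Matrix.mul_assoc, hX', Matrix.mul_assoc])
  obtain ⟨c', hc'⟩ := hπ.eq_smul_one (X * Xᴴ) (fun g => by
    rw [Matrix.mul_assoc, hX', ← Matrix.mul_assoc, hX, Matrix.mul_assoc])
  have hcc : c = c' := by
    have h1 : X * Xᴴ * X = c • X := by rw [Matrix.mul_assoc, hc]; simp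
    have h2 : X * Xᴴ * X = c' • X := by rw [hc']; simp
    have h3 : (c - c') • X = 0 := by rw [sub_smul, ← h1, ← h2, sub_self]
    rcases smul_eq_zero.1 h3 with h | h
    · exact sub_eq_zero.1 h
    · exact absurd h hX0
  subst hcc
  have hc0 : c ≠ 0 := by
    rintro rfl
    rw [zero_smul] at hc
    exact hX0 (Matrix.conjTranspose_mul_self_eq_zero.1 hc)
  let j : Fin ρ.dim := ⟨0, hρ.dim_pos⟩
  have hcr : c = ((∑ i, ‖X i j‖ ^ 2 : ℝ) : ℂ) := by
    have := congrFun (congrFun hc j) j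
    simp only [Matrix.mul_apply, Matrix.conjTranspose_apply, Matrix.smul_apply,
      Matrix.one_apply_eq, smul_eq_mul, mul_one] at this
    rw [← this]
    push_cast
    refine Finset.sum_congr rfl fun i _ => ?_
    rw [← Complex.conj_mul']; rfl
  set t : ℝ := ∑ i, ‖X i j‖ ^ 2 with ht
  have ht0 : 0 ≤ t := by positivity
  have htt : ((Real.sqrt t : ℝ) : ℂ) * ((Real.sqrt t : ℝ) : ℂ) = c := by
    rw [hcr, ← Complex.ofReal_mul, Real.mul_self_sqrt ht0]
  have hs0 : ((Real.sqrt t : ℝ) : ℂ) ≠ 0 := by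
    intro h0
    rw [h0, mul_zero] at htt
    exact hc0 htt.symm
  have hstar : star (((Real.sqrt t : ℝ) : ℂ)⁻¹) = ((Real.sqrt t : ℝ) : ℂ)⁻¹ := by
    simp
  have hcoef : ((Real.sqrt t : ℝ) : ℂ)⁻¹ * ((Real.sqrt t : ℝ) : ℂ)⁻¹ * c = 1 := by
    rw [← htt]; field_simp
  -- `X* X` and `X X*` are the same positive scalar `t`, so `X / √t` is unitary.
  refine hne ⟨((Real.sqrt t : ℝ) : ℂ)⁻¹ • X, ?_, ?_, fun g => ?_⟩
  · rw [Matrix.conjTranspose_smul, hstar, Matrix.smul_mul, Matrix.mul_smul, hc, smul_smul,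
      smul_smul, hcoef, one_smul]
  · rw [Matrix.conjTranspose_smul, hstar, Matrix.smul_mul, Matrix.mul_smul, hc', smul_smul,
      smul_smul, hcoef, one_smul]
  · rw [Matrix.smul_mul, Matrix.mul_smul, hX]

/-- A nonzero invariant subspace of a unitary representation contains the range of an isometric
intertwiner from an irreducible one. -/
lemma exists_isIrred_of_invariant {ι : Type*} [Fintype ι] [DecidableEq ι]
    (R : G → Matrix ι ι ℂ) (hR1 : R 1 = 1) (hRm : ∀ g h, R (g * h) = R g * R h)
    (hRs : ∀ g, R g⁻¹ = (R g)ᴴ) (V : Submodule ℂ (ι → ℂ))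
    (hV : ∀ g, ∀ v ∈ V, R g *ᵥ v ∈ V) (hne : V ≠ ⊥) :
    ∃ (σ : UnitaryRep G) (S : Matrix ι (Fin σ.dim) ℂ), σ.IsIrred ∧ Sᴴ * S = 1 ∧
      (∀ g, R g * S = S * σ.val g) ∧ ∀ x, S *ᵥ x ∈ V := by
  -- `W` is a minimal nonzero invariant subspace. With an orthonormal basis of `W` as the columns of
  -- `S`, the compression `S* R S` is a representation, irreducible by minimality.
  obtain ⟨W, ⟨hW0, hWV, hWi⟩, hmin⟩ := WellFounded.has_min
    (wellFounded_lt (α := Submodule ℂ (ι → ℂ)))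
    {W | W ≠ ⊥ ∧ W ≤ V ∧ ∀ g, ∀ v ∈ W, R g *ᵥ v ∈ W} ⟨V, hne, le_rfl, hV⟩
  let e := WithLp.linearEquiv 2 ℂ (ι → ℂ)
  let W' : Submodule ℂ (EuclideanSpace ℂ ι) := W.comap (e : EuclideanSpace ℂ ι →ₗ[ℂ] (ι → ℂ))
  let b := stdOrthonormalBasis ℂ W'
  let n := Module.finrank ℂ W'
  let S : Matrix ι (Fin n) ℂ := Matrix.of fun i j => (b j : EuclideanSpace ℂ ι) i
  have hcol : ∀ x : Fin n → ℂ, S *ᵥ x = e (∑ j, x j • (b j : EuclideanSpace ℂ ι)) := by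
    intro x
    ext i
    simp [S, Matrix.mulVec, dotProduct, e, mul_comm]
  have hSW : ∀ x, S *ᵥ x ∈ W := by
    intro x
    rw [hcol]
    exact W'.sum_mem fun j _ => W'.smul_mem _ (b j).2
  have hS : Sᴴ * S = 1 := by
    ext i j
    have := orthonormal_iff_ite.1 b.orthonormal i j
    rw [Matrix.one_apply, ← this, Submodule.coe_inner, Matrix.mul_apply, PiLp.inner_apply]
    refine Finset.sum_congr rfl fun k _ => ?_
    simp [S, mul_comm]
  have hWS : ∀ w ∈ W, S *ᵥ (Sᴴ *ᵥ w) = w := by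
    intro w hw
    have hw' : e.symm w ∈ W' := by simpa [W'] using hw
    have h1 := b.sum_repr ⟨e.symm w, hw'⟩
    have h2 : w = S *ᵥ (b.repr ⟨e.symm w, hw'⟩).ofLp := by
      rw [hcol]
      have h3 := congrArg (fun z : W' => e (z : EuclideanSpace ℂ ι)) h1
      simp only [Submodule.coe_sum, Submodule.coe_smul, LinearEquiv.apply_symm_apply] at h3
      exact h3.symm
    rw [h2, Matrix.mulVec_mulVec _ Sᴴ, hS, Matrix.one_mulVec]
  have hRS : ∀ g, S * (Sᴴ * R g * S) = R g * S := by
    intro g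
    refine Matrix.toLin'.injective (LinearMap.ext fun x => ?_)
    simp only [Matrix.toLin'_apply, ← Matrix.mulVec_mulVec]
    exact hWS _ (hWi g _ (hSW _))
  let τ : G → Matrix (Fin n) (Fin n) ℂ := fun g => Sᴴ * R g * S
  have hτ1 : τ 1 = 1 := by simp [τ, hR1, hS]
  have hτm : ∀ g h, τ (g * h) = τ g * τ h := by
    intro g h
    simp only [τ]
    rw [Matrix.mul_assoc (Sᴴ * R g), hRS, hRm]
    simp only [Matrix.mul_assoc]
  have hτs : ∀ g, τ g⁻¹ = (τ g)ᴴ := by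
    intro g
    simp only [τ, hRs, Matrix.conjTranspose_mul, Matrix.conjTranspose_conjTranspose,
      Matrix.mul_assoc]
  let σ : UnitaryRep G :=
    { dim := n
      mat :=
        { toFun := fun g => ⟨τ g, Matrix.mem_unitaryGroup_iff.2 (by
            rw [Matrix.star_eq_conjTranspose, ← hτs, ← hτm, mul_inv_cancel, hτ1])⟩
          map_one' := Subtype.ext hτ1
          map_mul' := fun g h => Subtype.ext (hτm g h) } }
  have hσ : ∀ g, R g * S = S * σ.val g := fun g => (hRS g).symm
  refine ⟨σ, S, ?_, hS, hσ, fun x => hWV (hSW x)⟩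
  have hnt : Nontrivial (Subrepresentation σ.toRepresentation) := by
    obtain ⟨w, hw, hw0⟩ := Submodule.exists_mem_ne_zero_of_ne_bot hW0
    refine ⟨⟨⊥, by intro g v hv; rw [Submodule.mem_bot] at hv ⊢; rw [hv, map_zero]⟩,
      ⟨⊤, fun _ _ _ => trivial⟩, fun h => ?_⟩
    have h1 : (⊥ : Submodule ℂ (Fin n → ℂ)) = ⊤ := congrArg Subrepresentation.toSubmodule h
    have h2 : Sᴴ *ᵥ w ∈ (⊥ : Submodule ℂ (Fin n → ℂ)) := h1 ▸ trivial
    rw [Submodule.mem_bot] at h2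
    rw [← hWS w hw, h2, Matrix.mulVec_zero] at hw0
    exact hw0 rfl
  refine { toNontrivial := hnt, eq_bot_or_eq_top := fun X => ?_ }
  let Y : Submodule ℂ (ι → ℂ) := X.toSubmodule.map (Matrix.toLin' S)
  by_cases hX : X.toSubmodule = ⊥
  · left
    exact Subrepresentation.toSubmodule_injective hX
  · right
    have hYi : ∀ g, ∀ v ∈ Y, R g *ᵥ v ∈ Y := by
      rintro g _ ⟨x, hx, rfl⟩
      refine ⟨σ.val g *ᵥ x, X.apply_mem_toSubmodule g hx, ?_⟩
      simp only [Matrix.toLin'_apply, Matrix.mulVec_mulVec, hσ]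
    have hYW : Y ≤ W := by
      rintro _ ⟨x, hx, rfl⟩
      exact hSW x
    have hinj : Function.Injective (Matrix.toLin' S) := by
      intro x y hxy
      have := congrArg (fun z => Sᴴ *ᵥ z) hxy
      simpa only [Matrix.toLin'_apply, Matrix.mulVec_mulVec, hS, Matrix.one_mulVec] using this
    have hY0 : Y ≠ ⊥ := by
      intro h
      exact hX (Submodule.map_injective_of_injective hinj (h.trans (Submodule.map_bot _).symm))
    have hYeq : Y = W := by
      by_contra hne'
      exact hmin Y ⟨hY0, hYW.trans hWV, hYi⟩ (lt_of_le_of_ne hYW hne')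
    apply Subrepresentation.toSubmodule_injective
    change X.toSubmodule = ⊤
    rw [eq_top_iff]
    intro x _
    have : Matrix.toLin' S x ∈ Y := by rw [hYeq]; exact hSW x
    obtain ⟨x', hx', hxx⟩ := this
    rwa [← hinj hxx]

end UnitaryRep

/-! ### Schur orthogonality, completeness of matrix coefficients, decomposition of tensor products.
-/

namespace UnitaryDual

variable {G : Type*} [Group G] {Γ : Type*} (D : UnitaryDual G Γ)

/-- The matrix `π(g)`. -/
abbrev val (π : Γ) (g : G) : Matrix (Fin (D.d π)) (Fin (D.d π)) ℂ := (D.rep π).val g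

/-- The matrix coefficient `π_{ij}` as a function on the group. -/
abbrev coeff (a : D.Idx) (g : G) : ℂ := D.val a.1 g a.2.1 a.2.2

lemma eq_zero_of_intertwines {π ρ : Γ} (h : π ≠ ρ) (X : Matrix (Fin (D.d π)) (Fin (D.d ρ)) ℂ)
    (hX : ∀ g, X * D.val ρ g = D.val π g * X) : X = 0 :=
  (D.irred π).eq_zero_of_not_equiv (D.irred ρ) (fun h' => h (D.eq_of_equiv _ _ h').symm) X hX

lemma d_pos (π : Γ) : 0 < D.d π := (D.irred π).dim_pos

variable [Fintype G]

/-- Averaging over the group produces an intertwiner from an arbitrary matrix; the substitution `g ↦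
hg` proves it. -/
lemma sum_val_mul_intertwines {m : Type*} [Fintype m] [DecidableEq m] (R : G → Matrix m m ℂ)
    (hR : ∀ g h, R (g * h) = R g * R h) (σ : Γ) (X : Matrix m (Fin (D.d σ)) ℂ) (h : G) :
    (∑ g, R g * X * (D.val σ g)ᴴ) * D.val σ h = R h * ∑ g, R g * X * (D.val σ g)ᴴ := by
  rw [Matrix.sum_mul, Matrix.mul_sum, ← Equiv.sum_comp (Equiv.mulLeft h)]
  refine Finset.sum_congr rfl fun g _ => ?_
  simp only [Equiv.coe_mulLeft, hR, val, UnitaryRep.val_mul, Matrix.conjTranspose_mul,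
    Matrix.mul_assoc, UnitaryRep.conjTranspose_mul_val, Matrix.mul_one]

/-- Schur's orthogonality relations. -/
lemma sum_coeff_mul_conj [DecidableEq Γ] (a b : D.Idx) :
    ∑ g, D.coeff a g * starRingEnd ℂ (D.coeff b g) =
      if a = b then (Fintype.card G : ℂ) / (D.d a.1 : ℂ) else 0 := by
  obtain ⟨π, i, j⟩ := a
  obtain ⟨ρ, k, l⟩ := b
  let X : Matrix (Fin (D.d π)) (Fin (D.d ρ)) ℂ := Matrix.single j l 1
  have hX := D.sum_val_mul_intertwines (D.val π) (UnitaryRep.val_mul _) ρ X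
  have hentry : ∑ g, D.val π g i j * starRingEnd ℂ (D.val ρ g k l) =
      (∑ g, D.val π g * X * (D.val ρ g)ᴴ) i k := by
    rw [Matrix.sum_apply]
    refine Finset.sum_congr rfl fun g _ => ?_
    rw [Matrix.mul_assoc, Matrix.mul_apply, Finset.sum_eq_single j]
    · simp [X, Matrix.mul_apply, Matrix.single_apply]
    · intro b _ hb
      simp [X, hb]
    · simp
  change ∑ g, D.val π g i j * starRingEnd ℂ (D.val ρ g k l) = _
  rw [hentry]
  by_cases hπρ : π = ρ
  · subst hπρ
    obtain ⟨c, hc⟩ := (D.irred π).eq_smul_one _ hX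
    have htr := congrArg Matrix.trace hc
    rw [Matrix.trace_sum, Matrix.trace_smul, Matrix.trace_one, Fintype.card_fin] at htr
    have htr' : ∀ g, (D.val π g * X * (D.val π g)ᴴ).trace = if j = l then 1 else 0 := by
      intro g
      rw [Matrix.trace_mul_comm, ← Matrix.mul_assoc, UnitaryRep.conjTranspose_mul_val,
        Matrix.one_mul]
      by_cases h : j = l
      · subst h; simp [X]
      · simp [X, h, Matrix.trace_single_eq_of_ne]
    simp only [htr', Finset.sum_const, Finset.card_univ] at htr
    have hd : (D.d π : ℂ) ≠ 0 := Nat.cast_ne_zero.2 (D.d_pos π).ne'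
    change _ = c • (D.d π : ℂ) at htr
    have hc' : c = (if j = l then (Fintype.card G : ℂ) else 0) / (D.d π : ℂ) := by
      rw [eq_div_iff hd, ← smul_eq_mul, ← htr]
      split_ifs <;> simp
    rw [hc, hc', Matrix.smul_apply, Matrix.one_apply]
    by_cases h1 : i = k <;> by_cases h2 : j = l <;> simp [h1, h2]
  · rw [D.eq_zero_of_intertwines hπρ _ hX, if_neg]
    · rfl
    · intro h
      exact hπρ (congrArg Sigma.fst h)

/-- Matrix coefficients of irreducible representations separate functions on the group. -/
lemma eq_zero_of_sum_conj_coeff (f : G → ℂ)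
    (hf : ∀ a, ∑ g, starRingEnd ℂ (D.coeff a g) * f g = 0) : f = 0 := by
  classical
  let R : G → Matrix G G ℂ := fun h => Matrix.of fun g k => if k = g * h then 1 else 0
  have hR : ∀ h f g, (R h *ᵥ f) g = f (g * h) := by
    intro h f g
    simp [R, Matrix.mulVec, dotProduct]
  -- `V` is the orthogonal complement of all matrix coefficients and is stable under right
  -- translation. If nonzero, it contains an irreducible subrepresentation, whose functions are
  -- combinations of coefficients and hence orthogonal to themselves.
  let V : Submodule ℂ (G → ℂ) :=
    { carrier := {f | ∀ a, ∑ g, starRingEnd ℂ (D.coeff a g) * f g = 0}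
      add_mem' := by
        intro x y hx hy a
        simp only [Pi.add_apply, mul_add, Finset.sum_add_distrib, hx a, hy a, add_zero]
      zero_mem' := by intro a; simp
      smul_mem' := by
        intro c x hx a
        simp only [Pi.smul_apply, smul_eq_mul, mul_left_comm _ c, ← Finset.mul_sum, hx a,
          mul_zero] }
  have hfV : f ∈ V := hf
  suffices hV : V = ⊥ by
    rw [hV] at hfV
    exact hfV
  by_contra hne
  obtain ⟨σ, S, hσ, hS, hRS, hSV⟩ := UnitaryRep.exists_isIrred_of_invariant R
    (by ext g k; simp [R, Matrix.one_apply, eq_comm])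
    (by
      intro g h
      refine Matrix.toLin'.injective (LinearMap.ext fun x => ?_)
      funext k
      simp only [Matrix.toLin'_apply, ← Matrix.mulVec_mulVec, hR, mul_assoc])
    (by
      intro g; ext h k
      simp only [R, Matrix.of_apply, Matrix.conjTranspose_apply, eq_mul_inv_iff_mul_eq]
      rw [apply_ite star, star_one, star_zero]
      simp only [eq_comm]) V
    (by
      rintro h v hv ⟨π, i, j⟩
      simp only [hR]
      rw [← Equiv.sum_comp (Equiv.mulRight h⁻¹)]
      simp only [Equiv.coe_mulRight, inv_mul_cancel_right, coeff, val, UnitaryRep.val_mul,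
        Matrix.mul_apply, map_sum, map_mul, Finset.sum_mul]
      rw [Finset.sum_comm]
      refine Finset.sum_eq_zero fun k _ => ?_
      have := hv ⟨π, i, k⟩
      simp only [mul_right_comm _ (starRingEnd ℂ _) (v _), ← Finset.sum_mul]
      rw [this, zero_mul]) hne
  obtain ⟨π, U, hU1, -, hU⟩ := D.exists_equiv σ hσ
  have hRS' : ∀ g, R g * (S * Uᴴ) = S * Uᴴ * D.val π g := by
    intro g
    have h1 : σ.val g * Uᴴ = Uᴴ * D.val π g := by
      have := congrArg Matrix.conjTranspose (hU g⁻¹)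
      change (U * σ.val g⁻¹)ᴴ = (D.val π g⁻¹ * U)ᴴ at this
      simpa only [val, Matrix.conjTranspose_mul, UnitaryRep.val_inv,
        Matrix.conjTranspose_conjTranspose] using this
    rw [← Matrix.mul_assoc, hRS, Matrix.mul_assoc, h1, Matrix.mul_assoc]
  have hzero : ∀ x, (S * Uᴴ) *ᵥ x = 0 := by
    intro x
    have hx : (S * Uᴴ) *ᵥ x ∈ V := by
      rw [← Matrix.mulVec_mulVec]; exact hSV _
    -- The value of a function at `g` is the value of its right translate by `g` at the identity.
    have hval : ∀ g, ((S * Uᴴ) *ᵥ x) g =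
        ∑ i, ∑ j, (S * Uᴴ) 1 i * D.val π g i j * x j := by
      intro g
      have h1 := hR g ((S * Uᴴ) *ᵥ x) 1
      rw [one_mul] at h1
      rw [← h1, Matrix.mulVec_mulVec, hRS', Finset.sum_comm]
      simp only [Matrix.mulVec, dotProduct]
      refine Finset.sum_congr rfl fun j _ => ?_
      rw [Matrix.mul_apply, Finset.sum_mul]
    set w := (S * Uᴴ) *ᵥ x with hw
    have hnorm : ∑ g, starRingEnd ℂ (w g) * w g = 0 := by
      have h2 : ∀ g, starRingEnd ℂ (w g) * w g = ∑ i, ∑ j, starRingEnd ℂ ((S * Uᴴ) 1 i) *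
          starRingEnd ℂ (x j) * (starRingEnd ℂ (D.coeff ⟨π, i, j⟩ g) * w g) := by
        intro g
        conv_lhs => rw [hval g]
        simp only [map_sum, map_mul, Finset.sum_mul]
        refine Finset.sum_congr rfl fun i _ => Finset.sum_congr rfl fun j _ => ?_
        rw [hval g]; ring
      simp only [h2]
      rw [Finset.sum_comm]
      refine Finset.sum_eq_zero fun i _ => ?_
      rw [Finset.sum_comm]
      refine Finset.sum_eq_zero fun j _ => ?_
      rw [← Finset.mul_sum, hx ⟨π, i, j⟩, mul_zero]
    have h3 : ∑ g, ‖w g‖ ^ 2 = 0 := by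
      have h4 : ((∑ g, ‖w g‖ ^ 2 : ℝ) : ℂ) = 0 := by
        rw [← hnorm]; push_cast
        exact Finset.sum_congr rfl fun g _ => (Complex.conj_mul' _).symm
      exact_mod_cast h4
    funext g
    have h5 := (Finset.sum_eq_zero_iff_of_nonneg (fun g _ => by positivity)).1 h3 g
      (Finset.mem_univ g)
    simpa using h5
  have h0 : S * Uᴴ = 0 := Matrix.toLin'.injective (LinearMap.ext fun x => by
    simpa using hzero x)
  have hS0 : S = 0 := by
    rw [← Matrix.mul_one S, ← hU1, ← Matrix.mul_assoc, h0, Matrix.zero_mul]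
  have h6 := congrFun (congrFun hS ⟨0, hσ.dim_pos⟩) ⟨0, hσ.dim_pos⟩
  rw [hS0, Matrix.mul_zero, Matrix.one_apply_eq] at h6
  exact zero_ne_one h6

lemma eq_zero_of_sum_coeff (f : G → ℂ) (hf : ∀ a, ∑ g, D.coeff a g * f g = 0) : f = 0 := by
  have h := D.eq_zero_of_sum_conj_coeff (fun g => starRingEnd ℂ (f g)) (fun a => by
    have := congrArg (starRingEnd ℂ) (hf a)
    simpa only [map_sum, map_mul, map_zero] using this)
  funext g
  have := congrFun h g
  simpa using this

/-- The ranges of all intertwiners from irreducible representations span `H_π ⊗ H_ρ`. -/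
lemma eq_zero_of_mul_intertwiners {κ : Type*} (π ρ : Γ)
    (Y : Matrix κ (Fin (D.d π) × Fin (D.d ρ)) ℂ)
    (hY : ∀ σ, ∀ T ∈ UnitaryRep.intertwiners (D.rep σ) (D.rep π) (D.rep ρ), Y * T = 0) :
    Y = 0 := by
  classical
  let R : G → Matrix (Fin (D.d π) × Fin (D.d ρ)) (Fin (D.d π) × Fin (D.d ρ)) ℂ :=
    fun g => D.val π g ⊗ₖ D.val ρ g
  have hRm : ∀ g h, R (g * h) = R g * R h := fun g h => by
    simp only [R, val, UnitaryRep.val_mul, Matrix.mul_kronecker_mul]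
  have hR1 : R 1 = 1 := by simp only [R, val, UnitaryRep.val_one, Matrix.one_kronecker_one]
  ext a p
  -- `Y` kills every averaged matrix unit. Read entrywise, `g ↦ (Y R(g))_{ap}` is orthogonal to all
  -- matrix coefficients, hence zero; its value at `1` is `Y_{ap}`.
  have hf := D.eq_zero_of_sum_conj_coeff (fun g => (Y * R g) a p) (by
    rintro ⟨σ, m, n⟩
    have h1 := hY σ _ (D.sum_val_mul_intertwines R hRm σ (Matrix.single p n 1))
    have h2 := congrFun (congrFun h1 a) m
    rw [Matrix.mul_sum, Matrix.sum_apply, Matrix.zero_apply] at h2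
    rw [← h2]
    refine Finset.sum_congr rfl fun g _ => ?_
    rw [← Matrix.mul_assoc, ← Matrix.mul_assoc, Matrix.mul_apply (N := (D.val σ g)ᴴ),
      Finset.sum_eq_single n]
    · simp [mul_comm]
    · intro b _ hb
      simp [hb]
    · simp)
  have := congrFun hf 1
  simp only [hR1, Matrix.mul_one] at this
  exact this

/-- The Fourier matrix `(√(dπ/|G|) π(g)_{ij})`. -/
def fourier : Matrix D.Idx G ℂ :=
  Matrix.of fun a g => ((Real.sqrt ((D.d a.1 : ℝ) / Fintype.card G) : ℝ) : ℂ) * D.coeff a g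

lemma sqrt_mul_sqrt_card (π : Γ) :
    ((Real.sqrt ((D.d π : ℝ) / Fintype.card G) : ℝ) : ℂ) *
      ((Real.sqrt ((D.d π : ℝ) / Fintype.card G) : ℝ) : ℂ) = (D.d π : ℂ) / Fintype.card G := by
  rw [← Complex.ofReal_mul, Real.mul_self_sqrt (by positivity)]
  push_cast; rfl

lemma fourier_mul_conjTranspose [DecidableEq Γ] : D.fourier * D.fourierᴴ = 1 := by
  ext a b
  simp only [fourier, Matrix.mul_apply, Matrix.of_apply, Matrix.conjTranspose_apply,
    Matrix.one_apply, star_mul', Complex.star_def, Complex.conj_ofReal]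
  simp only [mul_mul_mul_comm, ← Finset.mul_sum, D.sum_coeff_mul_conj]
  split_ifs with h
  · subst h
    rw [D.sqrt_mul_sqrt_card]
    have hd : (D.d a.1 : ℂ) ≠ 0 := Nat.cast_ne_zero.2 (D.d_pos a.1).ne'
    have hG : (Fintype.card G : ℂ) ≠ 0 := Nat.cast_ne_zero.2 Fintype.card_ne_zero
    field_simp
  · rw [mul_zero]

variable [Fintype Γ]

/-- That the two index sets have equal size is not available here, so the second half of unitarity
comes from completeness: `F` is injective and `F (F* F - 1) = 0`. -/
lemma fourier_conjTranspose_mul [DecidableEq G] : D.fourierᴴ * D.fourier = 1 := by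
  classical
  have key : ∀ Z : Matrix G G ℂ, D.fourier * Z = 0 → Z = 0 := by
    intro Z hZ
    ext h k
    refine congrFun (D.eq_zero_of_sum_coeff (fun g => Z g k) fun a => ?_) h
    have h1 := congrFun (congrFun hZ a) k
    simp only [fourier, Matrix.mul_apply, Matrix.of_apply, mul_assoc, ← Finset.mul_sum] at h1
    rcases mul_eq_zero.1 h1 with h2 | h2
    · exfalso
      have h3 := D.sqrt_mul_sqrt_card a.1
      rw [h2, mul_zero] at h3
      have hd : (D.d a.1 : ℂ) ≠ 0 := Nat.cast_ne_zero.2 (D.d_pos a.1).ne'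
      have hG : (Fintype.card G : ℂ) ≠ 0 := Nat.cast_ne_zero.2 Fintype.card_ne_zero
      exact div_ne_zero hd hG h3.symm
    · exact h2
  have := key (D.fourierᴴ * D.fourier - 1) (by
    rw [Matrix.mul_sub, ← Matrix.mul_assoc, D.fourier_mul_conjTranspose, Matrix.one_mul,
      Matrix.mul_one, sub_self])
  exact sub_eq_zero.1 this

/-- Completeness of the matrix coefficients. -/
lemma sum_coeff_completeness [DecidableEq G] (g h : G) :
    ∑ a : D.Idx, ((D.d a.1 : ℂ) / Fintype.card G) *
      (D.coeff a g * starRingEnd ℂ (D.coeff a h)) = if g = h then 1 else 0 := by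
  have h1 := congrFun (congrFun D.fourier_conjTranspose_mul h) g
  rw [Matrix.one_apply, Matrix.mul_apply] at h1
  simp only [eq_comm (a := g)]
  rw [← h1]
  refine Finset.sum_congr rfl fun a _ => ?_
  simp only [fourier, Matrix.of_apply, Matrix.conjTranspose_apply, star_mul', Complex.star_def,
    Complex.conj_ofReal]
  rw [← D.sqrt_mul_sqrt_card]
  ring

/-- The decomposition of `π ⊗ ρ` given by a choice of orthonormal bases of intertwiners. -/
lemma sum_T_mul_conjTranspose (B : D.IntertwinerBasis) (π ρ : Γ) :
    ∑ σ, ∑ e, B.T π ρ σ e * (B.T π ρ σ e)ᴴ = 1 := by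
  classical
  have hmem : ∀ σ e, B.T π ρ σ e ∈ UnitaryRep.intertwiners (D.rep σ) (D.rep π) (D.rep ρ) := by
    intro σ e
    rw [← B.span_eq]
    exact Submodule.subset_span ⟨e, rfl⟩
  have horth : ∀ σ τ e f, σ ≠ τ → (B.T π ρ σ e)ᴴ * B.T π ρ τ f = 0 := by
    intro σ τ e f hne
    refine D.eq_zero_of_intertwines hne _ fun g => ?_
    have h1 : (B.T π ρ σ e)ᴴ * (D.val π g ⊗ₖ D.val ρ g) = D.val σ g * (B.T π ρ σ e)ᴴ := by
      have := congrArg Matrix.conjTranspose (hmem σ e g⁻¹)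
      change (B.T π ρ σ e * D.val σ g⁻¹)ᴴ =
        ((D.val π g⁻¹ ⊗ₖ D.val ρ g⁻¹) * B.T π ρ σ e)ᴴ at this
      simpa only [val, Matrix.conjTranspose_mul, UnitaryRep.val_inv,
        Matrix.conjTranspose_conjTranspose, Matrix.conjTranspose_kronecker] using this.symm
    have h2 : B.T π ρ τ f * D.val τ g = (D.val π g ⊗ₖ D.val ρ g) * B.T π ρ τ f := hmem τ f g
    rw [Matrix.mul_assoc, h2, ← Matrix.mul_assoc, h1, Matrix.mul_assoc]
  -- By orthonormality and Schur, the sum fixes every basis intertwiner, and the ranges of these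
  -- span the tensor product.
  refine sub_eq_zero.1 (D.eq_zero_of_mul_intertwiners π ρ _ fun τ T hT => ?_)
  rw [← B.span_eq] at hT
  induction hT using Submodule.span_induction with
  | mem x hx =>
    obtain ⟨f, rfl⟩ := hx
    rw [Matrix.sub_mul, Matrix.one_mul, sub_eq_zero, Matrix.sum_mul, Finset.sum_eq_single τ]
    · rw [Matrix.sum_mul, Finset.sum_eq_single f]
      · rw [Matrix.mul_assoc, B.orthonormal, if_pos rfl, Matrix.mul_one]
      · intro e _ he
        rw [Matrix.mul_assoc, B.orthonormal, if_neg he, Matrix.mul_zero]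
      · simp
    · intro σ _ hσ
      rw [Matrix.sum_mul]
      refine Finset.sum_eq_zero fun e _ => ?_
      rw [Matrix.mul_assoc, horth _ _ _ _ hσ, Matrix.mul_zero]
    · simp
  | zero => rw [Matrix.mul_zero]
  | add x y _ _ hx hy => rw [Matrix.mul_add, hx, hy, add_zero]
  | smul c x _ hx => rw [Matrix.mul_smul, hx, smul_zero]

lemma sum_T_mul_val_mul_conjTranspose (B : D.IntertwinerBasis) (π ρ : Γ) (g : G) :
    ∑ σ, ∑ e, B.T π ρ σ e * D.val σ g * (B.T π ρ σ e)ᴴ = D.val π g ⊗ₖ D.val ρ g := by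
  have h : ∀ σ e, B.T π ρ σ e * D.val σ g = (D.val π g ⊗ₖ D.val ρ g) * B.T π ρ σ e := by
    intro σ e
    have : B.T π ρ σ e ∈ UnitaryRep.intertwiners (D.rep σ) (D.rep π) (D.rep ρ) := by
      rw [← B.span_eq]
      exact Submodule.subset_span ⟨e, rfl⟩
    exact this g
  simp only [h, Matrix.mul_assoc, ← Matrix.mul_sum, D.sum_T_mul_conjTranspose, Matrix.mul_one]

end UnitaryDual

/-! ### Actions of the dual as gradings by the group -/

/-- `c` is the family of projections onto the homogeneous components of a grading of the
*-algebra `A` by the group `G`. -/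
structure IsStarGrading {G : Type*} [Group G] [Fintype G] [DecidableEq G] {A : Type*} [Ring A]
    [StarRing A] [Algebra ℂ A] (c : G → A →ₗ[ℂ] A) : Prop where
  sum : ∀ x, ∑ g, c g x = x
  comp : ∀ g h x, c h (c g x) = if g = h then c g x else 0
  mul : ∀ g x y, c g (x * y) = ∑ h, c h x * c (h⁻¹ * g) y
  component_star : ∀ g x, c g (star x) = star (c g⁻¹ x)

namespace UnitaryDual

variable {G : Type*} [Group G] {Γ : Type*} (D : UnitaryDual G Γ)

lemma val_triv_apply {i j : Fin (D.d D.triv)} (g : G) : D.val D.triv g i j = 1 := by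
  have h : i = j := Fin.ext (by
    have := D.dim_triv
    have h1 := i.2
    have h2 := j.2
    change _ < (D.rep D.triv).dim at h1 h2
    omega)
  subst h
  simp [val, UnitaryRep.val, D.mat_triv]

variable [Fintype G]

/-! ### Fourier inversion for vector-valued functions on the group. -/

section Fourier

variable {V : Type*} [AddCommGroup V] [Module ℂ V] [Fintype Γ]

lemma sum_coeff_smul_fourier [DecidableEq Γ] (F : D.Idx → V) (a : D.Idx) :
    ∑ g, D.coeff a g • ∑ b : D.Idx,
      ((D.d b.1 : ℂ) / Fintype.card G * starRingEnd ℂ (D.coeff b g)) • F b = F a := by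
  simp only [Finset.smul_sum, smul_smul]
  rw [Finset.sum_comm]
  have h : ∀ b : D.Idx, ∑ g, (D.coeff a g * ((D.d b.1 : ℂ) / Fintype.card G *
      starRingEnd ℂ (D.coeff b g))) • F b = if a = b then F a else 0 := by
    intro b
    simp only [mul_left_comm (D.coeff a _), ← Finset.sum_smul, ← Finset.mul_sum,
      D.sum_coeff_mul_conj]
    split_ifs with hab
    · subst hab
      have hd : (D.d a.1 : ℂ) ≠ 0 := Nat.cast_ne_zero.2 (D.d_pos a.1).ne'
      have hG : (Fintype.card G : ℂ) ≠ 0 := Nat.cast_ne_zero.2 Fintype.card_ne_zero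
      rw [show (D.d a.1 : ℂ) / Fintype.card G * (Fintype.card G / D.d a.1) = 1 by field_simp,
        one_smul]
    · rw [mul_zero, zero_smul]
  simp only [h, Finset.sum_ite_eq, Finset.mem_univ, if_true]

lemma fourier_sum_coeff_smul (f : G → V) (h : G) :
    ∑ a : D.Idx, ((D.d a.1 : ℂ) / Fintype.card G * starRingEnd ℂ (D.coeff a h)) •
      ∑ g, D.coeff a g • f g = f h := by
  classical
  simp only [Finset.smul_sum, smul_smul]
  rw [Finset.sum_comm]
  have h1 : ∀ g, ∑ a : D.Idx, ((D.d a.1 : ℂ) / Fintype.card G *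
      starRingEnd ℂ (D.coeff a h) * D.coeff a g) • f g = if g = h then f g else 0 := by
    intro g
    have h2 : ∑ a : D.Idx, (D.d a.1 : ℂ) / Fintype.card G *
        starRingEnd ℂ (D.coeff a h) * D.coeff a g = if g = h then 1 else 0 := by
      rw [← D.sum_coeff_completeness]
      exact Finset.sum_congr rfl fun a _ => by ring
    rw [← Finset.sum_smul, h2, ite_smul, one_smul, zero_smul]
  simp only [h1, Finset.sum_ite_eq', Finset.mem_univ, if_true]

lemma eq_of_sum_coeff_smul {f f' : G → V}
    (h : ∀ a, ∑ g, D.coeff a g • f g = ∑ g, D.coeff a g • f' g) : f = f' := by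
  funext g
  rw [← D.fourier_sum_coeff_smul f, ← D.fourier_sum_coeff_smul f']
  simp only [h]

end Fourier

variable {A : Type*} [Ring A] [StarRing A] [Algebra ℂ A]
variable (α : ∀ π : Γ, A →⋆ₐ[ℂ] Matrix (Fin (D.d π)) (Fin (D.d π)) A)

/-- The component of degree `g` of an element of `A`. -/
def component [Fintype Γ] (g : G) : A →ₗ[ℂ] A where
  toFun x := ∑ a : D.Idx, ((D.d a.1 : ℂ) / Fintype.card G * starRingEnd ℂ (D.coeff a g)) •
    α a.1 x a.2.1 a.2.2
  map_add' x y := by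
    simp only [map_add, Matrix.add_apply, smul_add, Finset.sum_add_distrib]
  map_smul' c x := by
    simp only [map_smul, Matrix.smul_apply, Finset.smul_sum, RingHom.id_apply, smul_comm c]

variable [Fintype Γ]

lemma component_apply (g : G) (x : A) : D.component α g x =
    ∑ a : D.Idx, ((D.d a.1 : ℂ) / Fintype.card G * starRingEnd ℂ (D.coeff a g)) •
      α a.1 x a.2.1 a.2.2 := rfl

/-- The formula `α_π(x) = ∑_g π(g) ⊗ c_g(x)`, which determines the components; each property of the
grading is proved by comparing Fourier coefficients through it. -/
lemma action_apply (π : Γ) (x : A) (i j : Fin (D.d π)) :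
    α π x i j = ∑ g, D.val π g i j • D.component α g x := by
  classical
  exact (D.sum_coeff_smul_fourier (fun b : D.Idx => α b.1 x b.2.1 b.2.2) ⟨π, i, j⟩).symm

variable {D α}

lemma IsAction.sum_component (hα : D.IsAction α) (x : A) : ∑ g, D.component α g x = x := by
  let i : Fin (D.d D.triv) := ⟨0, D.d_pos _⟩
  have h := D.action_apply α D.triv x i i
  rw [hα.triv] at h
  simpa only [D.val_triv_apply, one_smul, Matrix.scalar_apply, Matrix.diagonal_apply_eq] using
    h.symm

/-- Multiplicativity of `α_π` and of `π`, compared coefficientwise, gives a convolution formula. -/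
lemma component_mul (g : G) (x y : A) :
    D.component α g (x * y) = ∑ h, D.component α h x * D.component α (h⁻¹ * g) y := by
  refine congrFun (D.eq_of_sum_coeff_smul (f := fun g => D.component α g (x * y))
    (f' := fun g => ∑ h, D.component α h x * D.component α (h⁻¹ * g) y) ?_) g
  rintro ⟨π, i, j⟩
  change ∑ g, D.val π g i j • _ = ∑ g, D.val π g i j • _
  rw [← action_apply, map_mul, Matrix.mul_apply]
  simp only [action_apply, Finset.smul_sum, Finset.sum_mul_sum, smul_mul_smul_comm]
  rw [Finset.sum_comm]
  conv_rhs => rw [Finset.sum_comm]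
  refine Finset.sum_congr rfl fun h _ => ?_
  rw [Finset.sum_comm]
  conv_rhs => rw [← Equiv.sum_comp (Equiv.mulLeft h)]
  refine Finset.sum_congr rfl fun k _ => ?_
  rw [Equiv.coe_mulLeft, inv_mul_cancel_left, ← Finset.sum_smul]
  simp only [val, UnitaryRep.val_mul, Matrix.mul_apply]

lemma component_star [StarModule ℂ A] (g : G) (x : A) :
    D.component α g (star x) = star (D.component α g⁻¹ x) := by
  refine congrFun (D.eq_of_sum_coeff_smul (f := fun g => D.component α g (star x))
    (f' := fun g => star (D.component α g⁻¹ x)) ?_) g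
  rintro ⟨π, i, j⟩
  change ∑ g, D.val π g i j • _ = ∑ g, D.val π g i j • _
  rw [← action_apply, map_star, Matrix.star_apply, action_apply, star_sum,
    ← Equiv.sum_comp (Equiv.inv G)]
  refine Finset.sum_congr rfl fun h _ => ?_
  simp only [Equiv.inv_apply, star_smul]
  congr 1
  simp only [val, UnitaryRep.val_inv, Matrix.conjTranspose_apply, star_star]

/-- The intertwiners exhaust `π ⊗ ρ`, so the action axiom upgrades to `(α_π ⊗ id)(α_ρ(x)) = ∑_g π(g)
⊗ ρ(g) ⊗ c_g(x)`. Expanding the left side in components gives a double sum over `h` and `g`, and two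
Fourier inversions show that only the diagonal survives. -/
lemma IsAction.component_component [DecidableEq G] (hα : D.IsAction α) (B : D.IntertwinerBasis)
    (g h : G) (x : A) : D.component α h (D.component α g x) =
      if g = h then D.component α g x else 0 := by
  have key : ∀ (π ρ : Γ) (p q : Fin (D.d π) × Fin (D.d ρ)), α π (α ρ x p.2 q.2) p.1 q.1 =
      ∑ g, (D.val π g p.1 q.1 * D.val ρ g p.2 q.2) • D.component α g x := by
    intro π ρ
    let M1 : Matrix (Fin (D.d π) × Fin (D.d ρ)) (Fin (D.d π) × Fin (D.d ρ)) A :=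
      Matrix.of fun p q => α π (α ρ x p.2 q.2) p.1 q.1
    let M2 : Matrix (Fin (D.d π) × Fin (D.d ρ)) (Fin (D.d π) × Fin (D.d ρ)) A :=
      Matrix.of fun p q => ∑ g, (D.val π g p.1 q.1 * D.val ρ g p.2 q.2) • D.component α g x
    have hT : ∀ σ e, M1 * (B.T π ρ σ e).map (algebraMap ℂ A) =
        M2 * (B.T π ρ σ e).map (algebraMap ℂ A) := by
      intro σ e
      have hmem : B.T π ρ σ e ∈
          UnitaryRep.intertwiners (D.rep σ) (D.rep π) (D.rep ρ) := by
        rw [← B.span_eq]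
        exact Submodule.subset_span ⟨e, rfl⟩
      refine (hα.intertwine π ρ σ _ hmem x).trans ?_
      have hmem' : ∀ g, B.T π ρ σ e * D.val σ g = (D.val π g ⊗ₖ D.val ρ g) * B.T π ρ σ e :=
        hmem
      ext p m
      have hl : ((B.T π ρ σ e).map (algebraMap ℂ A) * α σ x) p m =
          ∑ g, (B.T π ρ σ e * D.val σ g) p m • D.component α g x := by
        simp only [Matrix.mul_apply, Matrix.map_apply, action_apply, ← Algebra.smul_def,
          Finset.smul_sum, Finset.sum_smul, smul_smul]
        rw [Finset.sum_comm]
      rw [hl]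
      simp only [hmem']
      simp only [M2, Matrix.mul_apply, Matrix.of_apply, Matrix.map_apply,
        Matrix.kroneckerMap_apply, Finset.sum_mul, Finset.sum_smul]
      rw [Finset.sum_comm]
      refine Finset.sum_congr rfl fun q _ => Finset.sum_congr rfl fun g _ => ?_
      rw [← Algebra.commutes, ← Algebra.smul_def, smul_smul, mul_comm]
    have hone : ∑ σ, ∑ e, (B.T π ρ σ e).map (algebraMap ℂ A) *
        ((B.T π ρ σ e)ᴴ).map (algebraMap ℂ A) = 1 := by
      have h1 := congrArg (fun Z => (algebraMap ℂ A).mapMatrix Z)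
        (D.sum_T_mul_conjTranspose B π ρ)
      simp only [map_sum, map_one] at h1
      rw [← h1]
      refine Finset.sum_congr rfl fun σ _ => Finset.sum_congr rfl fun e _ => ?_
      rw [RingHom.mapMatrix_apply, Matrix.map_mul]
    have hM : M1 = M2 := by
      rw [← Matrix.mul_one M1, ← Matrix.mul_one M2, ← hone]
      simp only [Matrix.mul_sum, ← Matrix.mul_assoc, hT]
    intro p q
    exact congrFun (congrFun hM p) q
  have key2 : ∀ (ρ : Γ) (k l : Fin (D.d ρ)) (h : G),
      ∑ g, D.val ρ g k l • D.component α h (D.component α g x) =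
        D.val ρ h k l • D.component α h x := by
    intro ρ k l
    refine congrFun (D.eq_of_sum_coeff_smul
      (f := fun h => ∑ g, D.val ρ g k l • D.component α h (D.component α g x))
      (f' := fun h => D.val ρ h k l • D.component α h x) ?_)
    rintro ⟨π, i, j⟩
    have h1 := key π ρ (i, k) (j, l)
    simp only [action_apply D α ρ x] at h1
    rw [action_apply] at h1
    simp only [map_sum, map_smul] at h1
    simp only [coeff, smul_smul]
    exact h1
  refine congrFun (D.eq_of_sum_coeff_smul
    (f := fun g => D.component α h (D.component α g x))
    (f' := fun g => if g = h then D.component α g x else 0) ?_) g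
  rintro ⟨ρ, k, l⟩
  simp only [smul_ite, smul_zero, Finset.sum_ite_eq', Finset.mem_univ, if_true]
  exact key2 ρ k l h

lemma IsAction.isStarGrading [DecidableEq G] [StarModule ℂ A] (hα : D.IsAction α)
    (B : D.IntertwinerBasis) : IsStarGrading (D.component α) where
  sum := hα.sum_component
  comp := hα.component_component B
  mul := component_mul
  component_star := component_star

/-- Outerness in terms of the grading: the crossed product has trivial relative commutant. -/
lemma IsOuter.eq_const (hout : D.IsOuter α) (hα : D.IsAction α)
    (hfac : ∀ z : A, (∀ x, x * z = z * x) → ∃ c : ℂ, z = algebraMap ℂ A c) (a : G → A)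
    (ha : ∀ g h x, D.component α g x * a h = a (g * h) * D.component α g x) :
    ∃ c : ℂ, ∀ h, a h = algebraMap ℂ A c := by
  classical
  have h1 : ∀ π, π ≠ D.triv → ∀ i j, ∑ h, D.val π h i j • a h = 0 := by
    intro π hπ
    -- For `b = ∑_h π(h) ⊗ a_h` the commutation rule gives `α_π(x) b = ∑ π(gh) ⊗ a_{gh} c_g(x) = b
    -- (x ⊗ 1)`.
    have := hout π hπ (Matrix.of fun i j => ∑ h, D.val π h i j • a h) (fun x => by
      ext i k
      rw [Matrix.scalar_apply, Matrix.mul_diagonal, Matrix.mul_apply]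
      simp only [Matrix.of_apply, action_apply, Finset.sum_mul, Finset.mul_sum,
        smul_mul_smul_comm]
      conv_rhs => rw [← hα.sum_component x]
      simp only [Finset.mul_sum]
      rw [Finset.sum_comm]
      conv_lhs => enter [2, h]; rw [Finset.sum_comm]
      simp only [← Finset.sum_smul, ← Matrix.mul_apply]
      have hmul : ∀ g h, (D.val π h * D.val π g) i k = D.val π (h * g) i k := by
        intro g h
        simp only [val, UnitaryRep.val_mul]
      simp only [hmul, ha, smul_mul_assoc]
      rw [Finset.sum_comm]
      conv_rhs => rw [Finset.sum_comm]
      refine Finset.sum_congr rfl fun g _ => ?_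
      exact Equiv.sum_comp (Equiv.mulLeft g)
        (fun h => D.val π h i k • (a h * D.component α g x)))
    intro i j
    exact congrFun (congrFun this i) j
  -- The coefficient of `a` at the trivial representation is central, hence scalar; all other
  -- coefficients vanish, so `a` is constant.
  obtain ⟨c, hc⟩ := hfac (∑ h, a h) (fun x => by
    conv_lhs => rw [← hα.sum_component x]
    conv_rhs => rw [← hα.sum_component x]
    rw [Finset.sum_mul_sum, Finset.sum_mul_sum]
    conv_rhs => rw [Finset.sum_comm]
    refine Finset.sum_congr rfl fun g _ => ?_
    simp only [ha]
    exact Equiv.sum_comp (Equiv.mulLeft g) (fun h => a h * D.component α g x))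
  refine ⟨(Fintype.card G : ℂ)⁻¹ * c, fun h => ?_⟩
  have hG : (Fintype.card G : ℂ) ≠ 0 := Nat.cast_ne_zero.2 Fintype.card_ne_zero
  refine congrFun (D.eq_of_sum_coeff_smul (f := a)
    (f' := fun _ => algebraMap ℂ A ((Fintype.card G : ℂ)⁻¹ * c)) ?_) h
  rintro ⟨π, i, j⟩
  rw [← Finset.sum_smul]
  by_cases hπ : π = D.triv
  · subst hπ
    simp only [coeff, val_triv_apply, one_smul, hc, Finset.sum_const, Finset.card_univ,
      nsmul_eq_mul, mul_one, Algebra.algebraMap_eq_smul_one, smul_smul]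
    rw [mul_inv_cancel_left₀ hG]
  · have h2 := D.sum_coeff_mul_conj ⟨π, i, j⟩ ⟨D.triv, ⟨0, D.d_pos _⟩, ⟨0, D.d_pos _⟩⟩
    rw [if_neg (fun h => hπ (congrArg Sigma.fst h))] at h2
    simp only [coeff, val_triv_apply, map_one, mul_one] at h2
    simp only [coeff]
    rw [h2, zero_smul, h1 π hπ]

end UnitaryDual

/-! ### Graded C*-algebras with supports, polar decompositions and a trace -/

/-- `s` is the left support projection of the set `X`. -/
structure IsLeftSupport {A : Type*} [Ring A] [StarRing A] (X : Set A) (s : A) : Prop where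
  isSelfAdjoint : star s = s
  mul_self : s * s = s
  mul_eq : ∀ x ∈ X, s * x = x
  mul_eq_zero : ∀ y, (∀ x ∈ X, y * x = 0) → y * s = 0

/-- `A` has left support projections and polar decompositions. -/
structure HasSupportPolar (A : Type*) [Ring A] [StarRing A] : Prop where
  support : ∀ X : Set A, ∃ s, IsLeftSupport X s
  polar : ∀ b x : A, star b = b → star x * x = b * b →
    ∃ v, v * b = x ∧ ∀ y, b * y = 0 → v * y = 0

/-- `τ` is a faithful tracial state. -/
structure IsFaithfulTrace {A : Type*} [Ring A] [StarRing A] [Algebra ℂ A]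
    (τ : A →ₗ[ℂ] ℂ) : Prop where
  map_one : τ 1 = 1
  nonneg : ∀ x, 0 ≤ (τ (star x * x)).re ∧ (τ (star x * x)).im = 0
  faithful : ∀ x, τ (star x * x) = 0 → x = 0
  tracial : ∀ x y, τ (x * y) = τ (y * x)

/-! ### Projections, partial isometries and the trace in a C*-algebra. -/

section CStar

variable {A : Type*} [CStarAlgebra A]

/-- Apply the C*-identity to `v q - v`. -/
lemma mul_proj_eq_self {v q : A} (hv : star v * v = q) (hq : q * q = q) (hqs : star q = q) :
    v * q = v := by
  have h : star (v * q - v) * (v * q - v) = 0 := by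
    rw [star_sub, star_mul, hqs, mul_sub, sub_mul, sub_mul]
    have h1 : q * star v * (v * q) = q := by
      rw [mul_assoc, ← mul_assoc (star v), hv, hq, hq]
    have h2 : star v * (v * q) = q := by rw [← mul_assoc, hv, hq]
    have h3 : q * star v * v = q := by rw [mul_assoc, hv, hq]
    rw [h1, h2, h3, hv]; simp
  exact sub_eq_zero.1 ((CStarRing.star_mul_self_eq_zero_iff _).1 h)

lemma norm_proj_le_one {q : A} (hq : q * q = q) (hqs : star q = q) : ‖q‖ ≤ 1 := by
  have h := CStarRing.norm_star_mul_self (x := q)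
  rw [hqs, hq] at h
  nlinarith [norm_nonneg q]

section Family

variable {ι : Type*} [Fintype ι] [DecidableEq ι] {v : ι → A} {q : A}

lemma sum_mul_star_mul (hv : ∀ i j, star (v i) * v j = if i = j then q else 0)
    (hq : q * q = q) (hqs : star q = q) (j : ι) : (∑ i, v i * star (v i)) * v j = v j := by
  have h1 : v j * q = v j := mul_proj_eq_self (by rw [hv, if_pos rfl]) hq hqs
  rw [Finset.sum_mul, Finset.sum_eq_single j]
  · rw [mul_assoc, hv, if_pos rfl, h1]
  · intro i _ hi
    rw [mul_assoc, hv, if_neg hi, mul_zero]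
  · simp

lemma sum_mul_star_mul_self (hv : ∀ i j, star (v i) * v j = if i = j then q else 0)
    (hq : q * q = q) (hqs : star q = q) :
    (∑ i, v i * star (v i)) * (∑ i, v i * star (v i)) = ∑ i, v i * star (v i) := by
  conv_lhs => rw [Finset.mul_sum]
  refine Finset.sum_congr rfl fun j _ => ?_
  rw [← mul_assoc, sum_mul_star_mul hv hq hqs]

omit [DecidableEq ι] in
lemma star_sum_mul_star : star (∑ i, v i * star (v i)) = ∑ i, v i * star (v i) := by
  simp only [star_sum, star_mul, star_star]

end Family

lemma one_sub_mul_self {p : A} (hp : p * p = p) : (1 - p) * (1 - p) = 1 - p := by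
  rw [mul_sub, mul_one, sub_mul, one_mul, hp, sub_self, sub_zero]

/-- The fourth root of `x* x`. -/
lemma exists_fourth_root (x : A) : ∃ d : A, star d = d ∧ (d * d) * (d * d) = star x * x ∧
    (∀ y, Commute (star x * x) y → Commute d y) ∧
    ∀ S : StarSubalgebra ℂ A, IsClosed (S : Set A) → star x * x ∈ S → d ∈ S := by
  have ha : IsSelfAdjoint (star x * x) := IsSelfAdjoint.star_mul_self x
  have hpos : ∀ t ∈ spectrum ℝ (star x * x), 0 ≤ t := spectrum_star_mul_self_nonneg
  let f : ℝ → ℝ := fun t => Real.sqrt (Real.sqrt t)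
  have hf : Continuous f := Real.continuous_sqrt.comp Real.continuous_sqrt
  refine ⟨cfc f (star x * x), (cfc_predicate f (star x * x) : IsSelfAdjoint _).star_eq, ?_, ?_, ?_⟩
  · have hff : Continuous fun t => f t * f t := hf.mul hf
    rw [← cfc_mul f f _ hf.continuousOn hf.continuousOn,
      ← cfc_mul _ _ _ hff.continuousOn hff.continuousOn]
    conv_rhs => rw [← cfc_id ℝ (star x * x) ha]
    refine cfc_congr fun t ht => ?_
    have h0 := hpos t ht
    simp only [f, id]
    rw [Real.mul_self_sqrt (Real.sqrt_nonneg _), Real.mul_self_sqrt h0]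
  · intro y hy
    exact Commute.cfc hy (by rwa [ha.star_eq]) f
  · intro S hS hxS
    have := hS
    exact cfc_mem (𝕜' := ℂ) (s := S) f hxS

namespace IsFaithfulTrace

variable {τ : A →ₗ[ℂ] ℂ} (hτ : IsFaithfulTrace τ)
include hτ

lemma proj_nonneg {q : A} (hq : q * q = q) (hqs : star q = q) :
    0 ≤ (τ q).re ∧ (τ q).im = 0 := by
  have := hτ.nonneg q
  rwa [hqs, hq] at this

lemma eq_zero_of_proj {q : A} (hq : q * q = q) (hqs : star q = q) (h : (τ q).re = 0) :
    q = 0 := by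
  apply hτ.faithful
  rw [hqs, hq]
  exact Complex.ext h (hτ.proj_nonneg hq hqs).2

lemma proj_le_one {q : A} (hq : q * q = q) (hqs : star q = q) : (τ q).re ≤ 1 := by
  have := (hτ.proj_nonneg (one_sub_mul_self hq) (by rw [star_sub, hqs, star_one])).1
  rw [map_sub, hτ.map_one, Complex.sub_re, Complex.one_re] at this
  linarith

/-- Expand the real number `τ ((1 + y)²)`. -/
lemma im_eq_zero {y : A} (hy : star y = y) : (τ y).im = 0 := by
  have h1 := (hτ.nonneg (1 + y)).2
  have h2 := (hτ.nonneg y).2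
  rw [star_add, star_one, hy, mul_add, mul_one, add_mul, one_mul] at h1
  rw [hy] at h2
  simp only [map_add, Complex.add_im, hτ.map_one, Complex.one_im, h2] at h1
  linarith

end IsFaithfulTrace

end CStar

/-! ### Homogeneous elements, their supports and polar decompositions. -/

namespace IsStarGrading

variable {G : Type*} [Group G] [Fintype G] [DecidableEq G] {A : Type*} [CStarAlgebra A]
  {c : G → A →ₗ[ℂ] A} (hc : IsStarGrading c)
include hc

lemma apply_of_ne {g h : G} {x : A} (hx : c g x = x) (hgh : g ≠ h) : c h x = 0 := by
  rw [← hx, hc.comp, if_neg hgh]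

lemma component_mem (g : G) (x : A) : c g (c g x) = c g x := by
  rw [hc.comp, if_pos rfl]

lemma component_mul_left {g : G} {x : A} (hx : c g x = x) (k : G) (y : A) :
    c k (x * y) = x * c (g⁻¹ * k) y := by
  rw [hc.mul, Finset.sum_eq_single g, hx]
  · intro h _ hh
    rw [hc.apply_of_ne hx hh.symm, zero_mul]
  · simp

lemma component_mul_right {h : G} {y : A} (hy : c h y = y) (k : G) (x : A) :
    c k (x * y) = c (k * h⁻¹) x * y := by
  rw [hc.mul, Finset.sum_eq_single (k * h⁻¹)]
  · rw [mul_inv_rev, inv_inv, inv_mul_cancel_right, hy]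
  · intro l _ hl
    rw [hc.apply_of_ne hy, mul_zero]
    rintro rfl
    exact hl (by group)
  · simp

lemma mul_mem {g h : G} {x y : A} (hx : c g x = x) (hy : c h y = y) :
    c (g * h) (x * y) = x * y := by
  rw [hc.component_mul_left hx, inv_mul_cancel_left, hy]

lemma star_mem {g : G} {x : A} (hx : c g x = x) : c g⁻¹ (star x) = star x := by
  rw [hc.component_star, inv_inv, hx]

lemma star_mem_one {x : A} (hx : c 1 x = x) : c 1 (star x) = star x := by
  simpa using hc.star_mem hx

lemma mul_mem_one {x y : A} (hx : c 1 x = x) (hy : c 1 y = y) : c 1 (x * y) = x * y := by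
  simpa using hc.mul_mem hx hy

lemma mul_one_mem {g : G} {x y : A} (hx : c g x = x) (hy : c 1 y = y) :
    c g (x * y) = x * y := by
  simpa using hc.mul_mem hx hy

lemma one_mul_mem {g : G} {x y : A} (hx : c 1 x = x) (hy : c g y = y) :
    c g (x * y) = x * y := by
  simpa using hc.mul_mem hx hy

lemma one_mem : c 1 (1 : A) = 1 := by
  have h : ∀ x, x * c 1 (1 : A) = x := by
    intro x
    conv_rhs => rw [← hc.sum x]
    rw [← hc.sum x, Finset.sum_mul]
    refine Finset.sum_congr rfl fun g _ => ?_
    have h1 := hc.component_mul_left (hc.component_mem g x) g 1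
    rw [inv_mul_cancel, mul_one, hc.component_mem] at h1
    rw [hc.sum x, ← h1]
  simpa using h 1

lemma mul_star_mem {g h : G} {x y : A} (hx : c g x = x) (hy : c h y = y) :
    c (g * h⁻¹) (x * star y) = x * star y :=
  hc.mul_mem hx (hc.star_mem hy)

lemma mul_star_self_mem {g : G} {x y : A} (hx : c g x = x) (hy : c g y = y) :
    c 1 (x * star y) = x * star y := by
  simpa using hc.mul_star_mem hx hy

lemma star_mul_self_mem {g : G} {x y : A} (hx : c g x = x) (hy : c g y = y) :
    c 1 (star x * y) = star x * y := by
  simpa using hc.mul_mem (hc.star_mem hx) hy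

/-- The fixed point algebra. -/
def degreeOne : StarSubalgebra ℂ A where
  carrier := {x | c 1 x = x}
  mul_mem' := fun hx hy => hc.mul_mem_one hx hy
  add_mem' := fun {x y} hx hy => by
    change c 1 (x + y) = x + y
    rw [map_add]
    exact congrArg₂ _ hx hy
  algebraMap_mem' := fun r => by
    change c 1 (algebraMap ℂ A r) = algebraMap ℂ A r
    rw [Algebra.algebraMap_eq_smul_one, map_smul, hc.one_mem]
  star_mem' := fun hx => hc.star_mem_one hx

/-- For `g ≠ 1`, `c_g(s) b = c_g(s b) = c_g(b) = 0`, hence `c_g(s) s = 0`. The degree-one component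
of this product is `c_g(s) c_g(s)*`, so `c_g(s) = 0`. -/
lemma support_mem {b s : A} (hb : c 1 b = b) (hs : IsLeftSupport {b} s) : c 1 s = s := by
  have h0 : ∀ g, g ≠ 1 → c g s = 0 := by
    intro g hg
    have h1 : c g s * b = 0 := by
      have h2 := hc.component_mul_right hb g s
      rw [hs.mul_eq b rfl, inv_one, mul_one, hc.apply_of_ne hb hg.symm] at h2
      exact h2.symm
    have h2 : c g s * s = 0 := hs.mul_eq_zero _ (by rintro x rfl; exact h1)
    have h3 := hc.component_mul_left (hc.component_mem g s) 1 s
    rw [h2, map_zero, mul_one] at h3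
    have h4 : c g⁻¹ s = star (c g s) := by
      conv_lhs => rw [← hs.isSelfAdjoint]
      rw [hc.component_star, inv_inv]
    rw [h4] at h3
    exact (CStarRing.mul_star_self_eq_zero_iff _).1 h3.symm
  have h5 := hc.sum s
  rwa [Finset.sum_eq_single 1 (fun g _ hg => h0 g hg) (by simp)] at h5

/-- Polar decomposition of a homogeneous element. -/
lemma exists_polar (hA : HasSupportPolar A) {g : G} {b s x : A} (hb : c 1 b = b)
    (hbs : star b = b) (hs : IsLeftSupport {b} s) (hx : c g x = x)
    (hxb : star x * x = b * b) :
    ∃ v, c g v = v ∧ v * b = x ∧ star v * v = s ∧ v * s = v := by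
  obtain ⟨v, hv, hv0⟩ := hA.polar b x hbs hxb
  have hsb : s * b = b := hs.mul_eq b rfl
  have hbs' : b * s = b := by
    have := congrArg star hsb
    rwa [star_mul, hbs, hs.isSelfAdjoint] at this
  have hvs : v * s = v := by
    have := hv0 (1 - s) (by rw [mul_sub, mul_one, hbs', sub_self])
    rw [mul_sub, mul_one, sub_eq_zero] at this
    exact this.symm
  have hs1 := hc.support_mem hb hs
  have hsr : ∀ y, y * b = 0 → y * s = 0 := fun y hy =>
    hs.mul_eq_zero y (by rintro x rfl; exact hy)
  have hsl : ∀ y, b * y = 0 → s * y = 0 := by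
    intro y hy
    have h1 := hsr (star y) (by rw [← hbs, ← star_mul, hy, star_zero])
    rw [← hs.isSelfAdjoint, ← star_mul, star_eq_zero] at h1
    exact h1
  refine ⟨v, ?_, hv, ?_, hvs⟩
  -- `c_h(v) b = c_h(x) = 0` for `h ≠ g`, so `c_h(v) = c_h(v s) = c_h(v) s = 0`.
  · have h0 : ∀ h, h ≠ g → c h v = 0 := by
      intro h hh
      have h1 := hc.component_mul_right hb h v
      rw [hv, hc.apply_of_ne hx hh.symm, inv_one, mul_one] at h1
      have h2 := hc.component_mul_right hs1 h v
      rw [hvs, inv_one, mul_one, hsr _ h1.symm] at h2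
      exact h2
    have h5 := hc.sum v
    rwa [Finset.sum_eq_single g (fun h _ hh => h0 h hh) (by simp)] at h5
  · have h1 : b * ((star v * v - 1) * b) = 0 := by
      rw [sub_mul, one_mul, mul_sub, sub_eq_zero, ← hxb, ← hv, star_mul, hbs]
      simp only [mul_assoc]
    have h2 := hsl _ h1
    rw [← mul_assoc] at h2
    have h3 := hsr _ h2
    rw [mul_sub, sub_mul, mul_one, hs.mul_self, sub_eq_zero, ← mul_assoc, mul_assoc, hvs] at h3
    rw [← h3]
    nth_rewrite 1 [← hvs]
    rw [star_mul, hs.isSelfAdjoint]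

/-! ### Consequences of outerness for the fixed point algebra. -/

section Ergodic

variable (hA : HasSupportPolar A)
  (hout : ∀ a : G → A, (∀ g h x, c g x * a h = a (g * h) * c g x) →
    ∃ k : ℂ, ∀ h, a h = algebraMap ℂ A k)
include hA hout

/-- Let `z_h` be the left support of `A_h e`. Outerness forces the family `z` to be a constant
scalar, and `z_1 e = e` makes that scalar `1`. Now `f A_g e = 0` would give `f = f z_g = 0`. -/
lemma exists_mul_mul_ne_zero {e f : A} (he : e ≠ 0) (hf : f ≠ 0) (g : G) :
    ∃ x, c g x = x ∧ f * x * e ≠ 0 := by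
  by_contra! H
  choose z hz using fun h : G => hA.support {y | ∃ x, y = c h x * e}
  have hz1 : ∀ g h x, z (g * h) * (c g x * z h) = c g x * z h := by
    intro g h x
    have h1 : (1 - z (g * h)) * c g x * z h = 0 := by
      refine (hz h).mul_eq_zero _ ?_
      rintro _ ⟨y, rfl⟩
      have h2 : z (g * h) * (c g x * (c h y * e)) = c g x * (c h y * e) := by
        refine (hz (g * h)).mul_eq _ ⟨c g x * c h y, ?_⟩
        rw [hc.mul_mem (hc.component_mem g x) (hc.component_mem h y), mul_assoc]
      rw [mul_assoc, sub_mul, one_mul, h2, sub_self]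
    rw [sub_mul, one_mul, sub_mul, sub_eq_zero, mul_assoc] at h1
    exact h1.symm
  -- `A_g A_h e ⊆ A_{gh} e` gives `z_{gh} x z_h = x z_h` for `x ∈ A_g`; the same for `x*`, after
  -- taking adjoints, gives `z_{gh} x z_h = z_{gh} x`.
  obtain ⟨k, hk⟩ := hout z (fun g h x => by
    have h2 := congrArg star (hz1 g⁻¹ (g * h) (star x))
    rw [inv_mul_cancel_left, star_mul, star_mul, hc.component_star, inv_inv, star_star,
      (hz _).isSelfAdjoint, (hz _).isSelfAdjoint] at h2
    exact (hz1 g h x).symm.trans (by rw [← mul_assoc, h2]))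
  have h1 : z 1 * e = e := (hz 1).mul_eq e ⟨1, by rw [hc.one_mem, one_mul]⟩
  have hk1 : k = 1 := by
    rw [hk 1, ← Algebra.smul_def] at h1
    have h2 : (k - 1) • e = 0 := by rw [sub_smul, h1, one_smul, sub_self]
    rcases smul_eq_zero.1 h2 with h | h
    · exact sub_eq_zero.1 h
    · exact absurd h he
  have h3 : f * z g = 0 := (hz g).mul_eq_zero f (by
    rintro _ ⟨x, rfl⟩
    rw [← mul_assoc]
    exact H _ (hc.component_mem g x))
  rw [hk g, hk1, map_one, mul_one] at h3
  exact hf h3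

variable (hcont : ∀ g, Continuous (c g)) {τ : A →ₗ[ℂ] ℂ} (hτ : IsFaithfulTrace τ)
include hcont

omit hA hout in
lemma isClosed_degreeOne : IsClosed (hc.degreeOne : Set A) :=
  isClosed_eq (hcont 1) continuous_id

include hτ

omit hout in
/-- If the corner of `A₁` at `r` has no proper projections, its self-adjoint elements are
scalar. -/
lemma corner_scalar_of_selfAdjoint {r : A} (hr1 : c 1 r = r) (hr : r * r = r)
    (hrs : star r = r) (hr0 : r ≠ 0)
    (H : ∀ s, star s = s → s * s = s → c 1 s = s → r * s = s → s ≠ 0 → s = r) (y : A)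
    (hy1 : c 1 y = y) (hys : star y = y) (hry : r * y = y) : ∃ k : ℂ, y = k • r := by
  have hτr : (τ r).re ≠ 0 := fun h => hr0 (hτ.eq_zero_of_proj hr hrs h)
  have hτr' : τ r = ((τ r).re : ℂ) := Complex.ext (by simp) (by simp [(hτ.proj_nonneg hr hrs).2])
  have hτy : τ y = ((τ y).re : ℂ) := Complex.ext (by simp) (by simp [hτ.im_eq_zero hys])
  let t : ℝ := (τ y).re / (τ r).re
  -- The traceless part of `y`. Below, `d * d` is `|z|`; the extra square root lets faithfulness
  -- turn `τ |z| = 0` into `d = 0`.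
  let z : A := y - (t : ℂ) • r
  have hz1 : c 1 z = z := by simp only [z, map_sub, map_smul, hy1, hr1]
  have hzs : star z = z := by simp [z, hys, hrs]
  have hrz : r * z = z := by simp only [z, mul_sub, hry, mul_smul_comm, hr]
  have hzr : z * r = z := by
    have := congrArg star hrz
    rwa [star_mul, hzs, hrs] at this
  have hτz : τ z = 0 := by
    simp only [z, map_sub, map_smul, smul_eq_mul]
    rw [hτy, hτr', ← Complex.ofReal_mul, ← Complex.ofReal_sub]
    simp only [t]
    rw [div_mul_cancel₀ _ hτr, sub_self, Complex.ofReal_zero]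
  obtain ⟨d, hds, hdd, hdcomm, hdmem⟩ := exists_fourth_root z
  rw [hzs] at hdd hdcomm hdmem
  have hd1 : c 1 d = d :=
    hdmem hc.degreeOne (hc.isClosed_degreeOne hcont) (hc.mul_mem_one hz1 hz1)
  have hdz : Commute d z := hdcomm z (by simp [Commute, SemiconjBy, mul_assoc])
  have hbz : (d * d) * z = z * (d * d) := (hdz.mul_left hdz).eq
  have hbs : star (d * d) = d * d := by rw [star_mul, hds]
  have hb1 := hc.mul_mem_one hd1 hd1
  have hfin : τ (d * d) = 0 → z = 0 := by
    intro h
    have hd0 : d = 0 := hτ.faithful d (by rwa [hds])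
    rw [hd0] at hdd
    rw [← CStarRing.star_mul_self_eq_zero_iff, hzs, ← hdd]
    simp
  have hrb : r * (d * d) = d * d := by
    have h1 : (d * d) * (1 - r) = 0 := by
      rw [← CStarRing.star_mul_self_eq_zero_iff, star_mul, star_sub, star_one, hrs, hbs,
        mul_assoc, ← mul_assoc (d * d) (d * d), hdd, mul_assoc z, mul_sub z, mul_one, hzr,
        sub_self, mul_zero, mul_zero]
    have h2 := congrArg star h1
    rw [star_mul, star_sub, star_one, hrs, hbs, star_zero, sub_mul, one_mul, sub_eq_zero] at h2
    exact h2.symm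
  suffices hz0 : z = 0 from ⟨t, sub_eq_zero.1 hz0⟩
  -- The support of `|z| + z`, twice the positive part, is `0` or `r`. Then `|z| = -z` or `|z| = z`
  -- respectively, and either way `τ |z| = 0`.
  obtain ⟨s, hs⟩ := hA.support {d * d + z}
  have hps : star (d * d + z) = d * d + z := by rw [star_add, hbs, hzs]
  have hns : star (d * d - z) = d * d - z := by rw [star_sub, hbs, hzs]
  have hnp : (d * d - z) * (d * d + z) = 0 := by
    rw [sub_mul, mul_add, mul_add, hdd, hbz]; abel
  have hs1 : c 1 s = s := hc.support_mem (by rw [map_add, hb1, hz1]) hs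
  have hrs' : r * s = s := by
    have := hs.mul_eq_zero (1 - r) (by
      rintro x rfl
      rw [sub_mul, one_mul, mul_add, hrb, hrz, sub_self])
    rw [sub_mul, one_mul, sub_eq_zero] at this
    exact this.symm
  apply hfin
  by_cases hs0 : s = 0
  · have h1 := hs.mul_eq _ rfl
    rw [hs0, zero_mul] at h1
    have h2 := congrArg τ h1
    rw [map_zero, map_add, hτz, add_zero] at h2
    exact h2.symm
  · have hsr := H s hs.isSelfAdjoint hs.mul_self hs1 hrs' hs0
    have h1 : (d * d - z) * r = 0 := by
      rw [← hsr]
      exact hs.mul_eq_zero _ (by rintro x rfl; exact hnp)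
    have hbr : d * d * r = d * d := by
      have := congrArg star hrb
      rwa [star_mul, hbs, hrs] at this
    rw [sub_mul, hbr, hzr] at h1
    rw [sub_eq_zero.1 h1, hτz]

/-- The fixed point algebra has no minimal projections. -/
lemma exists_lt_proj (hinf : ¬ FiniteDimensional ℂ A) {r : A} (hr1 : c 1 r = r)
    (hr : r * r = r) (hrs : star r = r) (hr0 : r ≠ 0) :
    ∃ s, star s = s ∧ s * s = s ∧ c 1 s = s ∧ r * s = s ∧ s ≠ 0 ∧ s ≠ r := by
  by_contra! H
  have hτr : (τ r).re ≠ 0 := fun h => hr0 (hτ.eq_zero_of_proj hr hrs h)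
  have hτr' : τ r = ((τ r).re : ℂ) := Complex.ext (by simp) (by simp [(hτ.proj_nonneg hr hrs).2])
  have hτrpos : 0 < (τ r).re := lt_of_le_of_ne (hτ.proj_nonneg hr hrs).1 hτr.symm
  have hsa := hc.corner_scalar_of_selfAdjoint hA hcont hτ hr1 hr hrs hr0 H
  have hone : ∀ y, c 1 y = y → r * y = y → y * r = y → ∃ k : ℂ, y = k • r := by
    intro y hy1 hry hyr
    have hrsy : r * star y = star y := by
      have := congrArg star hyr
      rwa [star_mul, hrs] at this
    have hsy1 := hc.star_mem_one hy1
    obtain ⟨k, hk⟩ := hsa (y + star y) (by rw [map_add, hy1, hsy1])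
      (by rw [star_add, star_star, add_comm]) (by rw [mul_add, hry, hrsy])
    obtain ⟨l, hl⟩ := hsa (Complex.I • (y - star y)) (by rw [map_smul, map_sub, hy1, hsy1])
      (by rw [star_smul, star_sub, star_star, Complex.star_def, Complex.conj_I, neg_smul,
            ← smul_neg, neg_sub])
      (by rw [mul_smul_comm, mul_sub, hry, hrsy])
    refine ⟨(k - Complex.I * l) / 2, ?_⟩
    have h1 : y - star y = (-Complex.I * l) • r := by
      rw [mul_smul, ← hl, smul_smul]
      simp
    have h2 : (2 : ℂ) • y = (k - Complex.I * l) • r := by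
      rw [sub_eq_add_neg, ← neg_mul, add_smul, ← hk, ← h1, two_smul]
      abel
    rw [div_eq_inv_mul, mul_smul, ← h2, smul_smul]
    norm_num
  -- Each `r A_g r` is at most one-dimensional: if `X ≠ 0` lies in it, `X X* = k r` with `k ≠ 0`, so
  -- `y = k⁻¹ X (X* y)`, and `X* y` is a multiple of `r`.
  have hdim : ∀ g, ∃ X, ∀ y, c g y = y → r * y = y → y * r = y → ∃ k : ℂ, y = k • X := by
    intro g
    by_cases h0 : ∃ X, c g X = X ∧ r * X = X ∧ X * r = X ∧ X ≠ 0
    · obtain ⟨X, hX1, hrX, hXr, hX0⟩ := h0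
      refine ⟨X, fun y hy1 hry hyr => ?_⟩
      have hsX : r * star X = star X := by
        have := congrArg star hXr
        rwa [star_mul, hrs] at this
      have hXs : star X * r = star X := by
        have := congrArg star hrX
        rwa [star_mul, hrs] at this
      obtain ⟨k, hk⟩ := hone (X * star X) (hc.mul_star_self_mem hX1 hX1)
        (by rw [← mul_assoc, hrX]) (by rw [mul_assoc, hXs])
      obtain ⟨l, hl⟩ := hone (star X * y) (hc.star_mul_self_mem hX1 hy1)
        (by rw [← mul_assoc, hsX]) (by rw [mul_assoc, hyr])
      have hk0 : k ≠ 0 := by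
        rintro rfl
        rw [zero_smul] at hk
        exact hX0 ((CStarRing.mul_star_self_eq_zero_iff _).1 hk)
      refine ⟨k⁻¹ * l, ?_⟩
      have h1 : k • y = l • X := by
        calc k • y = (k • r) * y := by rw [smul_mul_assoc, hry]
          _ = X * (star X * y) := by rw [← hk, mul_assoc]
          _ = l • X := by rw [hl, mul_smul_comm, hXr]
      rw [mul_smul, ← h1, smul_smul, inv_mul_cancel₀ hk0, one_smul]
    · push Not at h0
      exact ⟨0, fun y hy1 hry hyr => ⟨0, by
        rw [zero_smul]; exact h0 y hy1 hry hyr⟩⟩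
  -- An orthogonal family of copies of `r` in `A_1` can be enlarged until it exhausts `1`: some `(1
  -- - p) x r` is nonzero, and rescaling makes it a partial isometry. The trace bound `n τ(r) ≤ 1`
  -- stops the process.
  have hfam : ∃ (n : ℕ) (v : Fin n → A), (∀ i, c 1 (v i) = v i) ∧
      (∀ i j, star (v i) * v j = if i = j then r else 0) ∧ ∑ i, v i * star (v i) = 1 := by
    by_contra! hno
    have hall : ∀ n : ℕ, ∃ v : Fin n → A, (∀ i, c 1 (v i) = v i) ∧
        (∀ i j, star (v i) * v j = if i = j then r else 0) := by
      intro n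
      induction n with
      | zero => exact ⟨fun i => i.elim0, fun i => i.elim0, fun i => i.elim0⟩
      | succ n ih =>
        obtain ⟨v, hv1, hv⟩ := ih
        have hs0 : 1 - ∑ i, v i * star (v i) ≠ 0 := fun h =>
          hno n v hv1 hv (sub_eq_zero.1 h).symm
        obtain ⟨x, hx1, hx⟩ := hc.exists_mul_mul_ne_zero hA hout hr0 hs0 1
        set p := ∑ i, v i * star (v i) with hp
        have hp1 : c 1 p = p := by
          rw [hp, map_sum]
          exact Finset.sum_congr rfl fun i _ => hc.mul_star_self_mem (hv1 i) (hv1 i)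
        set w := (1 - p) * x * r with hw
        have hw1 : c 1 w = w := hc.mul_mem_one (hc.mul_mem_one
          (by rw [map_sub, hc.one_mem, hp1]) hx1) hr1
        have hwr : w * r = w := by rw [hw, mul_assoc, hr]
        obtain ⟨k, hk⟩ := hone (star w * w) (hc.star_mul_self_mem hw1 hw1)
          (by
            have h1 := congrArg star hwr
            rw [star_mul, hrs] at h1
            rw [← mul_assoc, h1])
          (by rw [mul_assoc, hwr])
        have hkτ : (k.re : ℂ) = k ∧ 0 < k.re := by
          have h1 := congrArg τ hk
          rw [map_smul, smul_eq_mul, hτr'] at h1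
          have h2 := hτ.nonneg w
          rw [h1] at h2
          simp only [Complex.mul_re, Complex.mul_im, Complex.ofReal_re, Complex.ofReal_im,
            mul_zero, sub_zero, zero_add] at h2
          have him : k.im = 0 := by
            rcases mul_eq_zero.1 ((by linarith [h2.2] : k.im * (τ r).re = 0)) with h | h
            · exact h
            · exact absurd h hτr
          have hre : (k.re : ℂ) = k := Complex.ext (by simp) (by simp [him])
          refine ⟨hre, lt_of_le_of_ne (nonneg_of_mul_nonneg_left h2.1 hτrpos) fun h0 => ?_⟩
          rw [← hre, ← h0, Complex.ofReal_zero, zero_smul,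
            CStarRing.star_mul_self_eq_zero_iff] at hk
          exact hx hk
        have hsq : ((Real.sqrt k.re : ℝ) : ℂ) * ((Real.sqrt k.re : ℝ) : ℂ) = k := by
          rw [← Complex.ofReal_mul, Real.mul_self_sqrt hkτ.2.le, hkτ.1]
        have hsq0 : ((Real.sqrt k.re : ℝ) : ℂ) ≠ 0 :=
          Complex.ofReal_ne_zero.2 (Real.sqrt_pos.2 hkτ.2).ne'
        let u : A := ((Real.sqrt k.re : ℝ) : ℂ)⁻¹ • w
        have huu : star u * u = r := by
          have h1 : ((Real.sqrt k.re : ℝ) : ℂ)⁻¹ * ((Real.sqrt k.re : ℝ) : ℂ)⁻¹ * k = 1 := by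
            rw [← mul_inv, hsq, inv_mul_cancel₀]
            rintro rfl
            exact lt_irrefl _ hkτ.2
          simp only [u, star_smul, smul_mul_smul_comm, hk, smul_smul]
          rw [star_inv₀, Complex.star_def, Complex.conj_ofReal, h1, one_smul]
        have hvp : ∀ i, star (v i) * (1 - p) = 0 := by
          intro i
          have h1 := congrArg star (sum_mul_star_mul hv hr hrs i)
          rw [star_mul, star_sum_mul_star, ← hp] at h1
          rw [mul_sub, mul_one, h1, sub_self]
        have hvu : ∀ i, star (v i) * u = 0 := by
          intro i
          simp only [u, hw, mul_smul_comm]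
          rw [← mul_assoc, ← mul_assoc, hvp, zero_mul, zero_mul, smul_zero]
        have huv : ∀ i, star u * v i = 0 := by
          intro i
          have := congrArg star (hvu i)
          rwa [star_mul, star_star, star_zero] at this
        refine ⟨Fin.snoc v u, fun i => ?_, fun i j => ?_⟩
        · refine Fin.lastCases ?_ (fun i => ?_) i
          · simp only [Fin.snoc_last, u, map_smul, hw1]
          · simp only [Fin.snoc_castSucc, hv1]
        · refine Fin.lastCases ?_ (fun i => ?_) i <;> refine Fin.lastCases ?_ (fun j => ?_) j
          · simp only [Fin.snoc_last, huu, if_true]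
          · simp only [Fin.snoc_last, Fin.snoc_castSucc, huv]
            rw [if_neg (Fin.castSucc_lt_last j).ne']
          · simp only [Fin.snoc_last, Fin.snoc_castSucc, hvu]
            rw [if_neg (Fin.castSucc_lt_last i).ne]
          · simp only [Fin.snoc_castSucc, hv, Fin.castSucc_inj]
    obtain ⟨n, hn⟩ := exists_nat_gt (1 / (τ r).re)
    obtain ⟨v, -, hv⟩ := hall n
    have h1 := hτ.proj_le_one (sum_mul_star_mul_self hv hr hrs) star_sum_mul_star
    have h2 : τ (∑ i, v i * star (v i)) = n * τ r := by
      rw [map_sum]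
      simp only [hτ.tracial (v _), hv, if_true, Finset.sum_const, Finset.card_univ,
        Fintype.card_fin, nsmul_eq_mul]
    rw [h2, hτr', ← Complex.ofReal_natCast, ← Complex.ofReal_mul, Complex.ofReal_re] at h1
    rw [div_lt_iff₀ hτrpos] at hn
    linarith
  obtain ⟨n, v, hv1, hv, hsum⟩ := hfam
  choose X hX using hdim
  have hvr : ∀ i, v i * r = v i := fun i =>
    mul_proj_eq_self (by rw [hv, if_pos rfl]) hr hrs
  have hrv : ∀ i, r * star (v i) = star (v i) := by
    intro i
    have := congrArg star (hvr i)
    rwa [star_mul, hrs] at this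
  apply hinf
  refine Module.finite_def.2 ?_
  -- Cutting `A` by the finitely many copies of `r` leaves blocks spanned by the `X g`, so `A` would
  -- be finite dimensional.
  have htop : Submodule.span ℂ (Set.range
      fun t : Fin n × Fin n × G => v t.1 * X t.2.2 * star (v t.2.1)) = ⊤ := by
    rw [eq_top_iff]
    intro x _
    have hx : x = ∑ i, ∑ j, ∑ g, v i * c g (star (v i) * x * v j) * star (v j) := by
      have h1 : ∀ i j, ∑ g, v i * c g (star (v i) * x * v j) * star (v j) =
          (v i * star (v i)) * x * (v j * star (v j)) := by
        intro i j
        rw [← Finset.sum_mul, ← Finset.mul_sum, hc.sum]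
        simp only [mul_assoc]
      simp only [h1, ← Finset.mul_sum, ← Finset.sum_mul, hsum, one_mul, mul_one]
    rw [hx]
    refine Submodule.sum_mem _ fun i _ => Submodule.sum_mem _ fun j _ =>
      Submodule.sum_mem _ fun g _ => ?_
    have h2 : r * (star (v i) * x * v j) = star (v i) * x * v j := by
      rw [← mul_assoc, ← mul_assoc, hrv]
    have h3 : (star (v i) * x * v j) * r = star (v i) * x * v j := by
      rw [mul_assoc, hvr]
    have h4 := hc.component_mul_left hr1 g (star (v i) * x * v j)
    have h5 := hc.component_mul_right hr1 g (star (v i) * x * v j)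
    rw [h2, inv_one, one_mul] at h4
    rw [h3, inv_one, mul_one] at h5
    obtain ⟨k, hk⟩ := hX g _ (hc.component_mem g _) h4.symm h5.symm
    rw [hk, mul_smul_comm, smul_mul_assoc]
    exact Submodule.smul_mem _ _ (Submodule.subset_span ⟨(i, j, g), rfl⟩)
  rw [← htop]
  exact Submodule.fg_span (Set.finite_range _)

end Ergodic

end IsStarGrading

/-! ### Towers: existence under a projection, sums, and a full tower by maximality. -/

/-- A family of homogeneous partial isometries, one in each degree, with common initial projection
and mutually orthogonal final projections. -/
structure IsTower {G : Type*} [Group G] [DecidableEq G] {A : Type*} [Ring A] [StarRing A]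
    [Algebra ℂ A] (c : G → A →ₗ[ℂ] A) (V : G → A) : Prop where
  mem : ∀ g, c g (V g) = V g
  star_mul_eq : ∀ g h, star (V g) * V h = if g = h then V 1 else 0

namespace IsTower

variable {G : Type*} [Group G] [DecidableEq G] {A : Type*} [CStarAlgebra A]
  {c : G → A →ₗ[ℂ] A} {V : G → A} (hV : IsTower c V)
include hV

lemma star_one : star (V 1) = V 1 := by
  have h := hV.star_mul_eq 1 1
  rw [if_pos rfl] at h
  have h1 := congrArg star h
  rw [star_mul, star_star, h] at h1
  exact h1.symm

lemma one_mul_one : V 1 * V 1 = V 1 := by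
  have h := hV.star_mul_eq 1 1
  rwa [if_pos rfl, hV.star_one] at h

lemma mul_one (g : G) : V g * V 1 = V g :=
  mul_proj_eq_self (by rw [hV.star_mul_eq, if_pos rfl]) hV.one_mul_one hV.star_one

lemma norm_le_one (g : G) : ‖V g‖ ≤ 1 := by
  have h := CStarRing.norm_star_mul_self (x := V g)
  rw [hV.star_mul_eq, if_pos rfl] at h
  nlinarith [norm_nonneg (V g), norm_proj_le_one hV.one_mul_one hV.star_one]

end IsTower

namespace IsStarGrading

variable {G : Type*} [Group G] [Fintype G] [DecidableEq G] {A : Type*} [CStarAlgebra A]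
  {c : G → A →ₗ[ℂ] A} (hc : IsStarGrading c)
  (hA : HasSupportPolar A)
  (hout : ∀ a : G → A, (∀ g h x, c g x * a h = a (g * h) * c g x) →
    ∃ k : ℂ, ∀ h, a h = algebraMap ℂ A k)
  (hcont : ∀ g, Continuous (c g)) {τ : A →ₗ[ℂ] ℂ} (hτ : IsFaithfulTrace τ)
include hc hA hcont

/-- A nonzero homogeneous element yields a nonzero partial isometry with smaller supports. -/
lemma exists_partial_isometry {g : G} {x r q : A} (hx : c g x = x) (hx0 : x ≠ 0)
    (hr : r * x = x) (hq : x * q = x) (hqs : star q = q) :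
    ∃ u s, c g u = u ∧ c 1 s = s ∧ star s = s ∧ s * s = s ∧ s ≠ 0 ∧ star u * u = s ∧
      r * u = u ∧ q * s = s := by
  obtain ⟨d, hds, hdd, -, hdmem⟩ := exists_fourth_root x
  have hd1 : c 1 d = d :=
    hdmem hc.degreeOne (hc.isClosed_degreeOne hcont) (hc.star_mul_self_mem hx hx)
  set b := d * d with hb
  have hb1 : c 1 b = b := hc.mul_mem_one hd1 hd1
  have hbs : star b = b := by rw [hb, star_mul, hds]
  obtain ⟨s, hs⟩ := hA.support {b}
  obtain ⟨u, hu, hub, huu, hus⟩ := hc.exists_polar hA hb1 hbs hs hx hdd.symm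
  have hsr : ∀ y, y * b = 0 → y * s = 0 := fun y hy =>
    hs.mul_eq_zero y (by rintro x rfl; exact hy)
  refine ⟨u, s, hu, hc.support_mem hb1 hs, hs.isSelfAdjoint, hs.mul_self, ?_, huu, ?_, ?_⟩
  · intro h0
    have := hs.mul_eq b rfl
    rw [h0, zero_mul] at this
    rw [← this, mul_zero] at hub
    exact hx0 hub.symm
  · have h1 := hsr ((r - 1) * u) (by rw [mul_assoc, hub, sub_mul, hr, one_mul, sub_self])
    rw [mul_assoc, hus, sub_mul, one_mul, sub_eq_zero] at h1
    exact h1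
  · have h1 : b * (q - 1) = 0 := by
      rw [← CStarRing.star_mul_self_eq_zero_iff, star_mul, hbs, mul_assoc, ← mul_assoc b, hdd,
        mul_assoc (star x), mul_sub, hq, mul_one, sub_self, mul_zero, mul_zero]
    have h2 := congrArg star h1
    rw [star_mul, hbs, star_sub, hqs, star_one, star_zero] at h2
    have h3 := hsr _ h2
    rwa [sub_mul, one_mul, sub_eq_zero] at h3

include hout hτ

/-- To add a degree, split `r` properly as `s + (r - s)`: the degrees already treated live under
`s`, the new partial isometry has range under `r - s`, and all the others are cut down to its
smaller initial projection `p`. -/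
lemma exists_partial_tower (hinf : ¬ FiniteDimensional ℂ A) (t : Finset G) :
    ∀ r : A, c 1 r = r → r * r = r → star r = r → r ≠ 0 →
      ∃ (q : A) (V : G → A), c 1 q = q ∧ q * q = q ∧ star q = q ∧ q ≠ 0 ∧
        (∀ g ∈ t, c g (V g) = V g ∧ r * V g = V g) ∧
        ∀ g ∈ t, ∀ h ∈ t, star (V g) * V h = if g = h then q else 0 := by
  induction t using Finset.induction_on with
  | empty =>
    intro r hr1 hr hrs hr0
    exact ⟨r, 0, hr1, hr, hrs, hr0, by simp, by simp⟩
  | insert k t hk ih =>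
    intro r hr1 hr hrs hr0
    obtain ⟨s, hss, hs, hs1, hrs', hs0, hsr⟩ :=
      hc.exists_lt_proj hA hout hcont hτ hinf hr1 hr hrs hr0
    have hsr' : s * r = s := by
      have := congrArg star hrs'
      rwa [star_mul, hss, hrs] at this
    obtain ⟨q, V, hq1, hq, hqs, hq0, hV, hVV⟩ := ih s hs1 hs hss hs0
    obtain ⟨y, hy, hy0⟩ := hc.exists_mul_mul_ne_zero hA hout hq0 (sub_ne_zero.2 (Ne.symm hsr)) k
    obtain ⟨u, p, hu, hp1, hps, hp, hp0, huu, hru, hqp⟩ :=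
      hc.exists_partial_isometry hA hcont (x := (r - s) * y * q) (r := r - s) (q := q)
        (hc.mul_one_mem (hc.one_mul_mem (by rw [map_sub, hr1, hs1]) hy) hq1) hy0
        (by rw [← mul_assoc, ← mul_assoc]; congr 2
            rw [mul_sub, sub_mul, sub_mul, hr, hsr', hrs', hs]; abel)
        (by rw [mul_assoc, hq]) hqs
    have hpq : p * q = p := by
      have := congrArg star hqp
      rwa [star_mul, hps, hqs] at this
    have hVs : ∀ g ∈ t, star (V g) * s = star (V g) := by
      intro g hg
      have := congrArg star (hV g hg).2
      rwa [star_mul, hss] at this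
    have hVu : ∀ g ∈ t, star (V g) * u = 0 := by
      intro g hg
      rw [← hru, ← hVs g hg, mul_assoc, ← mul_assoc s, mul_sub, hsr', hs, sub_self, zero_mul,
        mul_zero]
    have huV : ∀ g ∈ t, star u * V g = 0 := by
      intro g hg
      have := congrArg star (hVu g hg)
      rwa [star_mul, star_star, star_zero] at this
    refine ⟨p, fun g => if g = k then u else V g * p, hp1, hp, hps, hp0, ?_, ?_⟩
    · intro g hg
      by_cases hgk : g = k
      · subst hgk
        simp only [if_true]
        refine ⟨hu, ?_⟩
        rw [← hru, ← mul_assoc, mul_sub, hr, hrs']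
      · have hgt : g ∈ t := (Finset.mem_insert.1 hg).resolve_left hgk
        simp only [if_neg hgk]
        refine ⟨hc.mul_one_mem (hV g hgt).1 hp1, ?_⟩
        rw [← (hV g hgt).2, ← mul_assoc, ← mul_assoc, hrs']
    · intro g hg h hh
      by_cases hgk : g = k
      · subst hgk
        by_cases hhk : h = g
        · subst hhk
          simp only [if_true, huu]
        · have hht : h ∈ t := (Finset.mem_insert.1 hh).resolve_left hhk
          simp only [if_true, if_neg hhk, if_neg (Ne.symm hhk)]
          rw [← mul_assoc, huV h hht, zero_mul]
      · have hgt : g ∈ t := (Finset.mem_insert.1 hg).resolve_left hgk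
        by_cases hhk : h = k
        · subst hhk
          simp only [if_true, if_neg hgk]
          rw [star_mul, mul_assoc, hVu g hgt, mul_zero]
        · have hht : h ∈ t := (Finset.mem_insert.1 hh).resolve_left hhk
          simp only [if_neg hgk, if_neg hhk]
          rw [star_mul, hps, mul_assoc, ← mul_assoc (star (V g)), hVV g hgt h hht]
          split_ifs
          · rw [hqp, hp]
          · rw [zero_mul, mul_zero]

/-- Every nonzero projection of degree one contains a nonzero tower. -/
lemma exists_tower_le (hinf : ¬ FiniteDimensional ℂ A) {r : A} (hr1 : c 1 r = r)
    (hr : r * r = r) (hrs : star r = r) (hr0 : r ≠ 0) :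
    ∃ V, IsTower c V ∧ V 1 ≠ 0 ∧ ∀ g, r * V g = V g := by
  obtain ⟨q, V, hq1, hq, hqs, hq0, hV, hVV⟩ :=
    hc.exists_partial_tower hA hout hcont hτ hinf Finset.univ r hr1 hr hrs hr0
  have hVm := fun g => (hV g (Finset.mem_univ g)).1
  have hVr := fun g => (hV g (Finset.mem_univ g)).2
  have hVs := fun g h => hVV g (Finset.mem_univ g) h (Finset.mem_univ h)
  have hVq : ∀ g, V g * q = V g := fun g =>
    mul_proj_eq_self (by rw [hVs, if_pos rfl]) hq hqs
  -- Multiplying by `V_1*` moves the common initial projection to `V_1 V_1*`, so that it becomes the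
  -- degree-one member itself.
  refine ⟨fun g => V g * star (V 1), ⟨fun g => ?_, fun g h => ?_⟩, ?_, fun g => ?_⟩
  · simpa using hc.mul_star_mem (hVm g) (hVm 1)
  · rw [star_mul, star_star, mul_assoc, ← mul_assoc (star (V g)), hVs]
    split_ifs
    · rw [← mul_assoc, hVq]
    · rw [zero_mul, mul_zero]
  · intro h
    have h1 := (CStarRing.mul_star_self_eq_zero_iff _).1 h
    have h2 := hVs 1 1
    rw [if_pos rfl, h1, mul_zero] at h2
    exact hq0 h2.symm
  · rw [← mul_assoc, hVr]

omit hout in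
/-- A pairwise orthogonal set of towers has a sum. -/
lemma exists_sum_towers (S : Set (G → A)) (hS : ∀ V ∈ S, IsTower c V)
    (hSp : S.Pairwise fun V W => ∀ g h, star (V g) * W h = 0) :
    ∃ v, IsTower c v ∧ ∀ W ∈ S, ∀ g, v g * W 1 = W g := by
  have hT : ∀ V : S, IsTower c (V : G → A) := fun V => hS V V.2
  have hne : ∀ {V W : S}, V ≠ W → ∀ g h, star ((V : G → A) g) * (W : G → A) h = 0 :=
    fun {V W} h => hSp V.2 W.2 (fun h' => h (Subtype.ext h'))
  -- Infinite sums of partial isometries need not converge in norm. The weights `τ(V_1)`, whose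
  -- finite sums are at most `1`, make `X_g = ∑ τ(V_1) V_g` absolutely convergent. Since `X_g* X_g =
  -- X_1²` for every `g`, the polar decompositions `X_g = v_g X_1` remove the weights.
  let w : S → ℝ := fun V => (τ ((V : G → A) 1)).re
  have hw0 : ∀ V, 0 ≤ w V := fun V =>
    (hτ.proj_nonneg (hT V).one_mul_one (hT V).star_one).1
  have hws : Summable w := by
    refine summable_of_sum_le (c := 1) hw0 fun u => ?_
    have h1 : (∑ V ∈ u, (V : G → A) 1) * (∑ V ∈ u, (V : G → A) 1) = ∑ V ∈ u, (V : G → A) 1 := by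
      rw [Finset.sum_mul]
      refine Finset.sum_congr rfl fun V hV => ?_
      rw [Finset.mul_sum, Finset.sum_eq_single V, (hT V).one_mul_one]
      · intro W _ hW
        rw [← (hT V).star_one, hne hW.symm]
      · intro h; exact absurd hV h
    have h2 : star (∑ V ∈ u, (V : G → A) 1) = ∑ V ∈ u, (V : G → A) 1 := by
      rw [star_sum]
      exact Finset.sum_congr rfl fun V _ => (hT V).star_one
    have h3 := hτ.proj_le_one h1 h2
    rw [map_sum, Complex.re_sum] at h3
    exact h3
  have hsum : ∀ g, Summable fun V : S => (w V : ℂ) • (V : G → A) g := by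
    intro g
    refine Summable.of_norm_bounded hws fun V => ?_
    rw [norm_smul, Complex.norm_real, Real.norm_of_nonneg (hw0 V)]
    exact mul_le_of_le_one_right (hw0 V) ((hT V).norm_le_one g)
  choose X hX using hsum
  have hXm : ∀ g, c g (X g) = X g := by
    intro g
    have h1 : HasSum (fun V : S => c g ((w V : ℂ) • (V : G → A) g)) (c g (X g)) :=
      (hX g).map (c g) (hcont g)
    simp only [map_smul, (hT _).mem] at h1
    exact h1.unique (hX g)
  have hXW : ∀ (W : S) g, X g * (W : G → A) 1 = (w W : ℂ) • (W : G → A) g := by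
    intro W g
    refine ((hX g).mul_right _).unique ?_
    have h1 := hasSum_single (f := fun V : S => (w V : ℂ) • (V : G → A) g * (W : G → A) 1) W
      (fun V hV => by
        simp only [smul_mul_assoc]
        have h2 : (V : G → A) 1 * (W : G → A) 1 = 0 := by
          rw [← (hT V).star_one, hne hV]
        rw [← (hT V).mul_one g, mul_assoc, h2, mul_zero, smul_zero])
    simp only [smul_mul_assoc, (hT W).mul_one] at h1 ⊢
    exact h1
  have hsX : ∀ g (W : S) h, star (X g) * (W : G → A) h =
      if g = h then (w W : ℂ) • (W : G → A) 1 else 0 := by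
    intro g W h
    have h0 := (hX g).star
    refine (h0.mul_right _).unique ?_
    have h1 := hasSum_single
      (f := fun V : S => star ((w V : ℂ) • (V : G → A) g) * (W : G → A) h) W
      (fun V hV => by
        rw [star_smul, smul_mul_assoc, hne hV, smul_zero])
    have h2 : star ((w W : ℂ) • (W : G → A) g) * (W : G → A) h =
        if g = h then (w W : ℂ) • (W : G → A) 1 else 0 := by
      rw [star_smul, smul_mul_assoc, (hT W).star_mul_eq, Complex.star_def, Complex.conj_ofReal,
        smul_ite, smul_zero]
    rw [h2] at h1
    exact h1
  have hXX : ∀ g h, star (X g) * X h = if g = h then star (X 1) * X 1 else 0 := by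
    intro g h
    have h1 := (hX h).mul_left (star (X g))
    have h2 := (hX 1).mul_left (star (X 1))
    simp only [mul_smul_comm, hsX, if_true] at h1 h2
    split_ifs with hgh
    · simp only [if_pos hgh] at h1
      exact h1.unique h2
    · simp only [if_neg hgh, smul_zero] at h1
      exact h1.unique hasSum_zero
  have hb : star (X 1) = X 1 := by
    have h1 := (hX 1).star
    refine h1.unique ?_
    convert hX 1 using 2 with V
    rw [star_smul, (hT V).star_one, Complex.star_def, Complex.conj_ofReal]
  obtain ⟨s, hs⟩ := hA.support {X 1}
  have hpol := fun g => hc.exists_polar hA (hXm 1) hb hs (hXm g)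
    (by rw [hXX, if_pos rfl, hb])
  choose v hv1 hvb hvv hvs using hpol
  have hsr : ∀ y, y * X 1 = 0 → y * s = 0 := fun y hy =>
    hs.mul_eq_zero y (by rintro x rfl; exact hy)
  have hv_one : v 1 = s := by
    have h1 := hsr (v 1 - s) (by rw [sub_mul, hvb, hs.mul_eq _ rfl, sub_self])
    rwa [sub_mul, hvs, hs.mul_self, sub_eq_zero] at h1
  refine ⟨v, ⟨hv1, fun g h => ?_⟩, fun W hW g => ?_⟩
  · split_ifs with hgh
    · rw [← hgh, hvv, hv_one]
    · have h1 : star (X g) * v h * X 1 = 0 := by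
        rw [mul_assoc, hvb, hXX, if_neg hgh]
      have h2 := hsr _ h1
      rw [mul_assoc, hvs] at h2
      have h3 : star (v h) * v g * X 1 = 0 := by
        rw [mul_assoc, hvb, ← star_star (X g), ← star_mul, h2, star_zero]
      have h4 := hsr _ h3
      rw [mul_assoc, hvs] at h4
      rw [← star_star (v h), ← star_mul, h4, star_zero]
  · let W' : S := ⟨W, hW⟩
    have h1 : v g * (X 1 * W 1) = X g * W 1 := by rw [← mul_assoc, hvb]
    rw [hXW W' g, hXW W' 1, mul_smul_comm] at h1
    -- A vanishing weight means `W = 0` by faithfulness; otherwise the weight cancels.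
    by_cases h0 : w W' = 0
    · have h2 : W 1 = 0 := hτ.eq_zero_of_proj (hS W hW).one_mul_one (hS W hW).star_one h0
      rw [← (hS W hW).mul_one g, h2, mul_zero, mul_zero]
    · exact smul_right_injective A (Complex.ofReal_ne_zero.2 h0) h1

/-- There is a tower whose final projections sum up to the identity. -/
lemma exists_full_tower (hinf : ¬ FiniteDimensional ℂ A) :
    ∃ v, IsTower c v ∧ ∑ g, v g * star (v g) = 1 := by
  obtain ⟨S, hS⟩ := zorn_subset {S : Set (G → A) | (∀ V ∈ S, IsTower c V) ∧
      S.Pairwise fun V W => ∀ g h, star (V g) * W h = 0} (by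
    intro C hC hchain
    refine ⟨⋃₀ C, ⟨?_, ?_⟩, fun s hs => Set.subset_sUnion_of_mem hs⟩
    · rintro V ⟨s, hs, hV⟩
      exact (hC hs).1 V hV
    · exact (Set.pairwise_sUnion hchain.directedOn).2 fun s hs => (hC hs).2)
  obtain ⟨⟨hS1, hS2⟩, hmax⟩ := hS
  obtain ⟨v, hv, hvW⟩ := hc.exists_sum_towers hA hcont hτ S hS1 hS2
  refine ⟨v, hv, ?_⟩
  by_contra hne
  set p := ∑ g, v g * star (v g) with hp
  have hpp : p * p = p := sum_mul_star_mul_self hv.star_mul_eq hv.one_mul_one hv.star_one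
  have hps : star p = p := star_sum_mul_star
  have hp1 : c 1 p = p := by
    rw [hp, map_sum]
    exact Finset.sum_congr rfl fun g _ => hc.mul_star_self_mem (hv.mem g) (hv.mem g)
  obtain ⟨U, hU, hU0, hUr⟩ := hc.exists_tower_le hA hout hcont hτ hinf (r := 1 - p)
    (by rw [map_sub, hc.one_mem, hp1]) (one_sub_mul_self hpp)
    (by rw [star_sub, star_one, hps]) (sub_ne_zero.2 (Ne.symm hne))
  have hpU : ∀ h, p * U h = 0 := by
    intro h
    have := hUr h
    rw [sub_mul, one_mul, sub_eq_self] at this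
    exact this
  have hpW : ∀ W ∈ S, ∀ g, p * W g = W g := by
    intro W hW g
    rw [← hvW W hW g, ← mul_assoc,
      sum_mul_star_mul hv.star_mul_eq hv.one_mul_one hv.star_one]
  have hWU : ∀ W ∈ S, ∀ g h, star (W g) * U h = 0 := by
    intro W hW g h
    rw [← hpW W hW g, star_mul, hps, mul_assoc, hpU, mul_zero]
  have hUW : ∀ W ∈ S, ∀ g h, star (U g) * W h = 0 := by
    intro W hW g h
    rw [← star_star (W h), ← star_mul, hWU W hW, star_zero]
  -- A tower under the complement is orthogonal to every member of `S`, so maximality puts it in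
  -- `S`; it is then orthogonal to itself.
  have hUS : U ∈ S := by
    refine hmax ⟨?_, ?_⟩ (Set.subset_insert U S) (Set.mem_insert U S)
    · intro V hV
      rcases Set.mem_insert_iff.1 hV with rfl | hV
      · exact hU
      · exact hS1 V hV
    · exact hS2.insert fun W hW _ => ⟨hUW W hW, hWU W hW⟩
  have h1 := hWU U hUS 1 1
  rw [hU.star_mul_eq, if_pos rfl] at h1
  exact hU0 h1

end IsStarGrading

/-! ### Von Neumann algebras have supports and polar decompositions -/

section Hilbert

variable {H : Type*} [NormedAddCommGroup H] [InnerProductSpace ℂ H] [CompleteSpace H]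

lemma VonNeumannAlgebra.isClosed (M : VonNeumannAlgebra H) :
    IsClosed (M.toStarSubalgebra : Set (H →L[ℂ] H)) := by
  rw [M.coe_toStarSubalgebra, ← M.centralizer_centralizer]
  exact Set.isClosed_centralizer _

lemma VonNeumannAlgebra.mem_of_commute {M : VonNeumannAlgebra H} {x : H →L[ℂ] H}
    (h : ∀ y ∈ M.commutant, y * x = x * y) : x ∈ M := by
  rw [← M.commutant_commutant]
  exact VonNeumannAlgebra.mem_commutant_iff.2 h

/-- The projection onto the closed span of the ranges works: this subspace is invariant under the
commutant, so its projection lies in the bicommutant. -/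
lemma VonNeumannAlgebra.exists_support (M : VonNeumannAlgebra H) (X : Set M.Elem) :
    ∃ s, IsLeftSupport X s := by
  let R : Submodule ℂ H := ⨆ x ∈ X, LinearMap.range ((x : H →L[ℂ] H) : H →ₗ[ℂ] H)
  let K := R.topologicalClosure
  have hmem : ∀ x ∈ X, ∀ ξ, (x : H →L[ℂ] H) ξ ∈ K := fun x hx ξ =>
    R.le_topologicalClosure (Submodule.mem_iSup_of_mem x (Submodule.mem_iSup_of_mem hx ⟨ξ, rfl⟩))
  have hmin : ∀ y : H →L[ℂ] H, ∀ L : Submodule ℂ H, IsClosed (L : Set H) →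
      (∀ x ∈ X, ∀ ξ, y ((x : H →L[ℂ] H) ξ) ∈ L) → ∀ η ∈ K, y η ∈ L := by
    intro y L hL h
    have h1 : R.topologicalClosure ≤ L.comap (y : H →ₗ[ℂ] H) := by
      refine Submodule.topologicalClosure_minimal _ (iSup₂_le fun x hx => ?_)
        (hL.preimage y.continuous)
      rintro _ ⟨ξ, rfl⟩
      exact h x hx ξ
    exact h1
  have hproj : IsStarProjection K.starProjection := isStarProjection_starProjection
  have hKM : K.starProjection ∈ M := by
    rw [VonNeumannAlgebra.IsStarProjection.mem_iff hproj]
    intro y hy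
    rw [Module.End.mem_invtSubmodule, Submodule.range_starProjection]
    refine hmin y K R.isClosed_topologicalClosure fun x hx ξ => ?_
    have h1 := VonNeumannAlgebra.mem_commutant_iff.1 hy x x.2
    have h2 : y ((x : H →L[ℂ] H) ξ) = (x : H →L[ℂ] H) (y ξ) :=
      (congrArg (fun T : H →L[ℂ] H => T ξ) h1).symm
    rw [h2]
    exact hmem x hx _
  refine ⟨⟨K.starProjection, hKM⟩, Subtype.ext hproj.isSelfAdjoint.star_eq,
    Subtype.ext hproj.isIdempotentElem, fun x hx => Subtype.ext ?_, fun y hy => Subtype.ext ?_⟩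
  · ext ξ
    exact Submodule.starProjection_eq_self_iff.2 (hmem x hx ξ)
  · ext ξ
    have h1 := hmin (y : H →L[ℂ] H) ⊥ isClosed_singleton (fun x hx ξ => by
      have h2 := congrArg (fun T : M.Elem => (T : H →L[ℂ] H) ξ) (hy x hx)
      exact h2) (K.starProjection ξ) (K.starProjection_apply_mem ξ)
    exact h1

/-- Since `‖x ξ‖ = ‖b ξ‖`, the map `b ξ ↦ x ξ` is well defined and isometric; extend it to the
closure `K` of the range of `b`, and by zero on `Kᗮ = ker b`. -/
lemma VonNeumannAlgebra.exists_polar (M : VonNeumannAlgebra H) (b x : M.Elem) (hb : star b = b)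
    (hx : star x * x = b * b) : ∃ v : M.Elem, v * b = x ∧ ∀ y, b * y = 0 → v * y = 0 := by
  let b' : H →L[ℂ] H := b
  let x' : H →L[ℂ] H := x
  have hb' : ContinuousLinearMap.adjoint b' = b' := congrArg Subtype.val hb
  have hx' : ContinuousLinearMap.adjoint x' * x' = b' * b' := congrArg Subtype.val hx
  have hnorm : ∀ ξ, ‖x' ξ‖ = ‖b' ξ‖ := by
    intro ξ
    have h1 : inner ℂ (x' ξ) (x' ξ) = inner ℂ (b' ξ) (b' ξ) := by
      rw [← ContinuousLinearMap.adjoint_inner_left, ← ContinuousLinearMap.adjoint_inner_left, hb']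
      exact congrArg (fun T : H →L[ℂ] H => inner ℂ (T ξ) ξ) hx'
    rw [inner_self_eq_norm_sq_to_K, inner_self_eq_norm_sq_to_K] at h1
    have h2 : ‖x' ξ‖ ^ 2 = ‖b' ξ‖ ^ 2 := by exact_mod_cast h1
    exact (sq_eq_sq₀ (norm_nonneg _) (norm_nonneg _)).1 h2
  let R : Submodule ℂ H := LinearMap.range (b' : H →ₗ[ℂ] H)
  let K := R.topologicalClosure
  let e : H →ₗ[ℂ] K :=
    (b' : H →ₗ[ℂ] H).codRestrict K fun ξ => R.le_topologicalClosure ⟨ξ, rfl⟩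
  have he : DenseRange e := by
    intro k
    rw [Metric.mem_closure_iff]
    intro ε hε
    obtain ⟨_, ⟨ξ, rfl⟩, h⟩ := Metric.mem_closure_iff.1 k.2 ε hε
    exact ⟨e ξ, ⟨ξ, rfl⟩, h⟩
  have hen : ∃ C : ℝ, ∀ ξ, ‖(x' : H →ₗ[ℂ] H) ξ‖ ≤ C * ‖e ξ‖ :=
    ⟨1, fun ξ => by rw [one_mul]; exact (hnorm ξ).le⟩
  let v : H →L[ℂ] H :=
    ((x' : H →ₗ[ℂ] H).extendOfNorm e).comp K.orthogonalProjectionOnto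
  have hvb : ∀ ξ, v (b' ξ) = x' ξ := by
    intro ξ
    have h1 : K.orthogonalProjectionOnto (b' ξ) = e ξ :=
      Submodule.orthogonalProjectionOnto_mem_subspace_eq_self (e ξ)
    change ((x' : H →ₗ[ℂ] H).extendOfNorm e) (K.orthogonalProjectionOnto (b' ξ)) = _
    rw [h1, LinearMap.extendOfNorm_eq he hen]
    rfl
  have hker : ∀ η, b' η = 0 ↔ η ∈ Kᗮ := by
    intro η
    rw [Submodule.orthogonal_closure, ContinuousLinearMap.orthogonal_range, hb']
    rfl
  have hv0 : ∀ η, b' η = 0 → v η = 0 := by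
    intro η hη
    change ((x' : H →ₗ[ℂ] H).extendOfNorm e) (K.orthogonalProjectionOnto η) = _
    rw [Submodule.orthogonalProjectionOnto_eq_zero_iff.2 ((hker η).1 hη), map_zero]
  have hvM : v ∈ M := by
    refine VonNeumannAlgebra.mem_of_commute fun y hy => ?_
    have hyc : ∀ z ∈ M, ∀ ξ, y (z ξ) = z (y ξ) := fun z hz ξ =>
      (congrArg (fun T : H →L[ℂ] H => T ξ) (VonNeumannAlgebra.mem_commutant_iff.1 hy z hz)).symm
    -- Commutation with `y` in the commutant holds on `K` by density, and on `Kᗮ = ker b` because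
    -- `y` preserves this kernel.
    have hK : K ≤ LinearMap.ker ((y * v - v * y : H →L[ℂ] H) : H →ₗ[ℂ] H) := by
      refine Submodule.topologicalClosure_minimal _ ?_ (y * v - v * y).isClosed_ker
      rintro _ ⟨ξ, rfl⟩
      change y (v (b' ξ)) - v (y (b' ξ)) = 0
      rw [hyc b' b.2, hvb, hvb, hyc x' x.2, sub_self]
    ext η
    have h1 : y (v (K.starProjection η)) - v (y (K.starProjection η)) = 0 :=
      hK (K.starProjection_apply_mem η)
    have h2 := (hker _).2 (K.sub_starProjection_mem_orthogonal η)
    have h3 := hv0 _ h2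
    have h4 := hv0 (y (η - K.starProjection η)) (by rw [← hyc b' b.2, h2, map_zero])
    change y (v η) = v (y η)
    rw [← sub_add_cancel η (K.starProjection η), map_add v, map_add y, map_add y, map_add v, h3,
      h4, map_zero, zero_add, zero_add]
    exact sub_eq_zero.1 h1
  refine ⟨⟨v, hvM⟩, Subtype.ext ?_, fun y hy => Subtype.ext ?_⟩
  · ext ξ
    exact hvb ξ
  · ext ξ
    exact hv0 _ (congrArg (fun T : M.Elem => (T : H →L[ℂ] H) ξ) hy)

lemma VonNeumannAlgebra.hasSupportPolar (M : VonNeumannAlgebra H) : HasSupportPolar M.Elem :=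
  ⟨M.exists_support, M.exists_polar⟩

end Hilbert

/-! ### Continuity of the components and the equivariant matrix units -/

namespace UnitaryDual

variable {G : Type*} [Group G] [Fintype G] {Γ : Type*} [Fintype Γ] (D : UnitaryDual G Γ)

/-- Matrices over `A` form a C*-algebra, so the *-homomorphism `α_π` is contractive, and so are its
entries. -/
lemma continuous_component {A : Type*} [CStarAlgebra A]
    (α : ∀ π : Γ, A →⋆ₐ[ℂ] Matrix (Fin (D.d π)) (Fin (D.d π)) A) (g : G) :
    Continuous (D.component α g) := by
  let _ := CStarAlgebra.spectralOrder A
  have := CStarAlgebra.spectralOrderedRing A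
  have h : ∀ (π : Γ) (i j : Fin (D.d π)), Continuous fun x => α π x i j := by
    intro π i j
    let L : A →ₗ[ℂ] A :=
      { toFun := fun x => α π x i j
        map_add' := fun x y => by rw [map_add]; rfl
        map_smul' := fun k x => by rw [map_smul]; rfl }
    let φ : A →⋆ₐ[ℂ] CStarMatrix (Fin (D.d π)) (Fin (D.d π)) A :=
      (CStarMatrix.ofMatrixStarAlgEquiv : _ ≃⋆ₐ[ℂ] _).toStarAlgHom.comp (α π)
    exact AddMonoidHomClass.continuous_of_bound L 1 fun x => by
      rw [one_mul]
      exact (CStarMatrix.norm_entry_le_norm (M := φ x) (i := i) (j := j)).trans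
        (NonUnitalStarAlgHom.norm_apply_le φ x)
  change Continuous fun x => D.component α g x
  simp only [component_apply]
  exact continuous_finsetSum _ fun a _ => (h a.1 a.2.1 a.2.2).const_smul _

/-! ### From a full tower to equivariant matrix units. -/

section MatrixUnits

variable {A : Type*} [CStarAlgebra A]

/-- The Fourier transform of a family indexed by the group. -/
def fourierFamily (v : G → A) (a : D.Idx) : A := ∑ g, D.fourier a g • v g

variable {D}

omit [Fintype Γ] in
lemma star_fourierFamily_mul [DecidableEq Γ] [DecidableEq G] {c : G → A →ₗ[ℂ] A} {v : G → A} (hv : IsTower c v) (a b : D.Idx) :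
    star (D.fourierFamily v a) * D.fourierFamily v b = if a = b then v 1 else 0 := by
  have h1 : ∑ g, D.fourier b g * starRingEnd ℂ (D.fourier a g) = if b = a then 1 else 0 := by
    rw [← Matrix.one_apply, ← D.fourier_mul_conjTranspose]
    rfl
  simp only [fourierFamily, star_sum, star_smul, Finset.sum_mul_sum, smul_mul_smul_comm,
    hv.star_mul_eq, smul_ite, smul_zero, Finset.sum_ite_eq, Finset.mem_univ, if_true,
    ← Finset.sum_smul]
  rw [Finset.sum_congr rfl fun g _ => mul_comm _ _]
  refine (congrArg (· • v 1) h1).trans ?_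
  simp only [eq_comm (a := b)]
  split_ifs
  · rw [one_smul]
  · rw [zero_smul]

omit [Fintype Γ] in
lemma fourierFamily_mul [DecidableEq Γ] [DecidableEq G] {c : G → A →ₗ[ℂ] A} {v : G → A} (hv : IsTower c v) (a : D.Idx) :
    D.fourierFamily v a * v 1 = D.fourierFamily v a :=
  mul_proj_eq_self (by rw [star_fourierFamily_mul hv, if_pos rfl]) hv.one_mul_one hv.star_one

omit [Fintype Γ] in
lemma fourierFamily_mul_star (v : G → A) (a b : D.Idx) :
    D.fourierFamily v a * star (D.fourierFamily v b) =
      ∑ g, ∑ h, (D.fourier a g * starRingEnd ℂ (D.fourier b h)) • (v g * star (v h)) := by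
  simp only [fourierFamily, star_sum, star_smul, Finset.sum_mul_sum, smul_mul_smul_comm]
  rfl

lemma sum_fourierFamily_mul_star (v : G → A) :
    ∑ a, D.fourierFamily v a * star (D.fourierFamily v a) = ∑ g, v g * star (v g) := by
  classical
  have h1 : ∀ g h, ∑ a, D.fourier a g * starRingEnd ℂ (D.fourier a h) =
      if h = g then 1 else 0 := by
    intro g h
    rw [← Matrix.one_apply, ← D.fourier_conjTranspose_mul, Matrix.mul_apply]
    exact Finset.sum_congr rfl fun a _ => mul_comm _ _
  simp only [fourierFamily_mul_star]
  rw [Finset.sum_comm]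
  refine Finset.sum_congr rfl fun g _ => ?_
  rw [Finset.sum_comm]
  simp only [← Finset.sum_smul, h1, ite_smul, one_smul, zero_smul, Finset.sum_ite_eq',
    Finset.mem_univ, if_true]

lemma isMatrixUnits_of_isTower [DecidableEq Γ] [DecidableEq G] {c : G → A →ₗ[ℂ] A} {v : G → A} (hv : IsTower c v)
    (hsum : ∑ g, v g * star (v g) = 1) :
    D.IsMatrixUnits fun a b => D.fourierFamily v a * star (D.fourierFamily v b) where
  mul a b a' b' := by
    rw [mul_assoc, ← mul_assoc (star _), star_fourierFamily_mul hv]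
    split_ifs
    · rw [← mul_assoc, fourierFamily_mul hv]
    · rw [zero_mul, mul_zero]
  star a b := by rw [star_mul, star_star]
  sum := by rw [sum_fourierFamily_mul_star, hsum]

omit [Fintype Γ] in
lemma sqrt_div_mul_sqrt_mul_sqrt (ρ σ : Γ) :
    ((Real.sqrt ((D.d ρ : ℝ) / (D.d σ : ℝ)) : ℝ) : ℂ) *
      ((Real.sqrt ((D.d σ : ℝ) / Fintype.card G) : ℝ) : ℂ) *
      ((Real.sqrt ((D.d ρ : ℝ) / Fintype.card G) : ℝ) : ℂ) = (D.d ρ : ℂ) / Fintype.card G := by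
  rw [← D.sqrt_mul_sqrt_card, ← Complex.ofReal_mul, ← Real.sqrt_mul (by positivity)]
  have hd : (D.d σ : ℝ) ≠ 0 := Nat.cast_ne_zero.2 (D.d_pos σ).ne'
  rw [div_mul_div_cancel₀ hd]

/-- The factor `√(dρ/dσ)` cancels the `σ`-dependence of the Fourier normalisations, leaving
`dρ/|G|`. The sum over `σ, m, n, e` then reassembles `π(g) ⊗ ρ(g)`, and the sum over `ρ, k, l` is
completeness of the coefficients. -/
lemma sum_lambda_coeff [DecidableEq G] (B : D.IntertwinerBasis) (π : Γ) (i j : Fin (D.d π)) (g h : G) :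
    ∑ ρ : Γ, ∑ k : Fin (D.d ρ), ∑ l : Fin (D.d ρ),
      ∑ σ : Γ, ∑ m : Fin (D.d σ), ∑ n : Fin (D.d σ), ∑ e : Fin (B.N π ρ σ),
        (((Real.sqrt ((D.d ρ : ℝ) / (D.d σ : ℝ)) : ℝ) : ℂ) *
          B.T π ρ σ e (i, k) m * starRingEnd ℂ (B.T π ρ σ e (j, l) n)) *
          (D.fourier ⟨σ, (m, n)⟩ g * starRingEnd ℂ (D.fourier ⟨ρ, (k, l)⟩ h)) =
      if g = h then D.val π g i j else 0 := by
  have h1 : ∀ ρ k l, ∑ σ : Γ, ∑ m : Fin (D.d σ), ∑ n : Fin (D.d σ), ∑ e : Fin (B.N π ρ σ),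
        (((Real.sqrt ((D.d ρ : ℝ) / (D.d σ : ℝ)) : ℝ) : ℂ) *
          B.T π ρ σ e (i, k) m * starRingEnd ℂ (B.T π ρ σ e (j, l) n)) *
          (D.fourier ⟨σ, (m, n)⟩ g * starRingEnd ℂ (D.fourier ⟨ρ, (k, l)⟩ h)) =
      D.val π g i j * ((D.d ρ : ℂ) / Fintype.card G *
        (D.val ρ g k l * starRingEnd ℂ (D.val ρ h k l))) := by
    intro ρ k l
    have h2 := congrFun (congrFun (D.sum_T_mul_val_mul_conjTranspose B π ρ g) (i, k)) (j, l)
    simp only [Matrix.sum_apply, Matrix.mul_apply, Matrix.kroneckerMap_apply,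
      Matrix.conjTranspose_apply, Finset.sum_mul] at h2
    rw [show D.val π g i j * ((D.d ρ : ℂ) / Fintype.card G *
        (D.val ρ g k l * starRingEnd ℂ (D.val ρ h k l))) = (D.val π g i j * D.val ρ g k l) *
        ((D.d ρ : ℂ) / Fintype.card G * starRingEnd ℂ (D.val ρ h k l)) by ring, ← h2,
      Finset.sum_mul]
    refine Finset.sum_congr rfl fun σ _ => ?_
    conv_lhs => rw [Finset.sum_comm]
    conv_lhs => enter [2, n]; rw [Finset.sum_comm]
    conv_lhs => rw [Finset.sum_comm]
    simp only [Finset.sum_mul]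
    refine Finset.sum_congr rfl fun e _ => Finset.sum_congr rfl fun n _ =>
      Finset.sum_congr rfl fun m _ => ?_
    rw [← D.sqrt_div_mul_sqrt_mul_sqrt ρ σ]
    simp only [fourier, Matrix.of_apply, map_mul, Complex.conj_ofReal, coeff, Complex.star_def]
    ring
  simp only [h1, ← Finset.mul_sum]
  have h3 := D.sum_coeff_completeness g h
  rw [Fintype.sum_sigma] at h3
  simp only [Fintype.sum_prod_type, ← Finset.mul_sum] at h3
  refine (congrArg (D.val π g i j * ·) h3).trans ?_
  simp only [mul_ite, mul_one, mul_zero]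

lemma lambdaE_fourierFamily [DecidableEq G] (B : D.IntertwinerBasis) (v : G → A) (π : Γ) (i j : Fin (D.d π)) :
    D.lambdaE B (fun a b => D.fourierFamily v a * star (D.fourierFamily v b)) π i j =
      ∑ g, D.val π g i j • (v g * star (v g)) := by
  -- Pulling the sevenfold sum inside one linear map reduces the claim to a scalar identity in `g`
  -- and `h`.
  let L : (G → G → ℂ) →ₗ[ℂ] A :=
    { toFun := fun f => ∑ g, ∑ h, f g h • (v g * star (v h))
      map_add' := fun f f' => by
        simp only [Pi.add_apply, add_smul, Finset.sum_add_distrib]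
      map_smul' := fun r f => by
        simp only [Pi.smul_apply, smul_eq_mul, mul_smul, Finset.smul_sum, RingHom.id_apply] }
  have hL : ∀ a b, D.fourierFamily v a * star (D.fourierFamily v b) =
      L fun g h => D.fourier a g * starRingEnd ℂ (D.fourier b h) := fun a b =>
    fourierFamily_mul_star v a b
  simp only [lambdaE, Matrix.of_apply, hL, ← map_smul, ← map_sum]
  have hf : ∀ f : G → G → ℂ, (∀ g h, f g h = if g = h then D.val π g i j else 0) →
      L f = ∑ g, D.val π g i j • (v g * star (v g)) := by
    intro f hf
    change ∑ g, ∑ h, f g h • (v g * star (v h)) = _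
    simp only [hf, ite_smul, zero_smul, Finset.sum_ite_eq, Finset.mem_univ, if_true]
  refine hf _ fun g h => ?_
  simp only [Finset.sum_apply, Pi.smul_apply, smul_eq_mul]
  exact sum_lambda_coeff B π i j g h

lemma action_apply_of_mem [DecidableEq G] (α : ∀ π : Γ, A →⋆ₐ[ℂ] Matrix (Fin (D.d π)) (Fin (D.d π)) A)
    (hc : IsStarGrading (D.component α)) {k : G} {x : A} (hx : D.component α k x = x) (π : Γ)
    (i j : Fin (D.d π)) : α π x i j = D.val π k i j • x := by
  rw [action_apply, Finset.sum_eq_single k, hx]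
  · intro h _ hh
    rw [hc.apply_of_ne hx hh.symm, smul_zero]
  · simp

/-- Cut `x` by the projections `v_g v_g*` and `v_h v_h*`: the corner has degree `gh⁻¹`, so `α_π`
acts on it as `π(gh⁻¹)`, while conjugation by `λ_π^E` gives `π(g) π(h)*`. -/
lemma isEquivariant_of_isTower [DecidableEq Γ] [DecidableEq G] (B : D.IntertwinerBasis)
    (α : ∀ π : Γ, A →⋆ₐ[ℂ] Matrix (Fin (D.d π)) (Fin (D.d π)) A)
    (hc : IsStarGrading (D.component α)) {v : G → A} (hv : IsTower (D.component α) v)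
    (hsum : ∑ g, v g * star (v g) = 1) :
    D.IsEquivariant B α fun a b => D.fourierFamily v a * star (D.fourierFamily v b) := by
  intro π a b
  set x := D.fourierFamily v a * star (D.fourierFamily v b) with hx
  have hp : ∀ g h, v g * star (v g) * x * (v h * star (v h)) =
      (D.fourier a g * starRingEnd ℂ (D.fourier b h)) • (v g * star (v h)) := by
    have hpw : ∀ a g, v g * star (v g) * D.fourierFamily v a = D.fourier a g • v g := by
      intro a g
      simp only [fourierFamily, Finset.mul_sum, mul_smul_comm, mul_assoc, hv.star_mul_eq, mul_ite,
        mul_zero, smul_ite, smul_zero, Finset.sum_ite_eq, Finset.mem_univ, if_true, hv.mul_one]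
    intro g h
    have h1 := congrArg star (hpw b h)
    rw [star_mul, star_mul, star_star, star_smul] at h1
    rw [hx, mul_assoc (v g * star (v g)), mul_assoc (D.fourierFamily v a), h1, ← mul_assoc, hpw,
      smul_mul_smul_comm]
    rfl
  have hmem : ∀ g h, D.component α (g * h⁻¹) (v g * star (v g) * x * (v h * star (v h))) =
      v g * star (v g) * x * (v h * star (v h)) := by
    intro g h
    rw [hp, map_smul, hc.mul_star_mem (hv.mem g) (hv.mem h)]
  have hxs : x = ∑ g, ∑ h, v g * star (v g) * x * (v h * star (v h)) := by
    simp only [← Finset.mul_sum, ← Finset.sum_mul, hsum, one_mul, mul_one]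
  have hproj : ∀ g, star (v g * star (v g)) = v g * star (v g) := fun g => by
    rw [star_mul, star_star]
  ext i j
  have hl : α π x i j = ∑ g, ∑ h, D.val π (g * h⁻¹) i j •
      (v g * star (v g) * x * (v h * star (v h))) := by
    conv_lhs => rw [hxs]
    simp only [map_sum, Matrix.sum_apply]
    exact Finset.sum_congr rfl fun g _ => Finset.sum_congr rfl fun h _ =>
      action_apply_of_mem α hc (hmem g h) π i j
  rw [hl, Matrix.mul_apply]
  simp only [Matrix.scalar_apply, Matrix.mul_diagonal, Matrix.star_apply, lambdaE_fourierFamily,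
    star_sum, star_smul, hproj, Finset.sum_mul, Finset.mul_sum, smul_mul_assoc, mul_smul_comm]
  simp only [Finset.smul_sum, smul_smul]
  conv_rhs => rw [Finset.sum_comm]
  conv_rhs => enter [2, h]; rw [Finset.sum_comm]
  conv_rhs => rw [Finset.sum_comm]
  refine Finset.sum_congr rfl fun g _ => Finset.sum_congr rfl fun h _ => ?_
  rw [← Finset.sum_smul]
  congr 1
  simp only [val, UnitaryRep.val_mul, UnitaryRep.val_inv, Matrix.mul_apply,
    Matrix.conjTranspose_apply]
  exact Finset.sum_congr rfl fun l _ => mul_comm _ _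

end MatrixUnits

end UnitaryDual

end

theorem mainTheorem4 {G : Type*} [Group G] [Finite G]
    {Γ : Type*} [Fintype Γ] [DecidableEq Γ]
    (D : UnitaryDual G Γ) (B : D.IntertwinerBasis)
    {H : Type*} [NormedAddCommGroup H] [InnerProductSpace ℂ H] [CompleteSpace H]
    (M : VonNeumannAlgebra H) (hM : M.IsTypeIIOneFactor)
    (α : ∀ π : Γ, M.Elem →⋆ₐ[ℂ] Matrix (Fin (D.d π)) (Fin (D.d π)) M.Elem)
    (hα : D.IsAction α) (hout : D.IsOuter α) :
    ∃ E : D.Idx → D.Idx → M.Elem, D.IsMatrixUnits E ∧ D.IsEquivariant B α E := by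
  classical
  have := Fintype.ofFinite G
  have hclosed := M.isClosed
  let _ : CStarAlgebra M.Elem := StarSubalgebra.cstarAlgebra M.toStarSubalgebra
  obtain ⟨τ, hτ⟩ := hM.exists_trace
  have hτ' : IsFaithfulTrace τ := ⟨hτ.map_one, hτ.nonneg, hτ.faithful, hτ.tracial⟩
  have hc : IsStarGrading (D.component α) := hα.isStarGrading B
  have hfac : ∀ z : M.Elem, (∀ x, x * z = z * x) → ∃ k : ℂ, z = algebraMap ℂ M.Elem k := by
    intro z hz
    obtain ⟨k, hk⟩ := hM.isFactor z z.2 (VonNeumannAlgebra.mem_commutant_iff.2 fun x hx =>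
      congrArg Subtype.val (hz ⟨x, hx⟩))
    exact ⟨k, Subtype.ext (hk.trans (Algebra.algebraMap_eq_smul_one k).symm)⟩
  obtain ⟨v, hv, hsum⟩ := hc.exists_full_tower M.hasSupportPolar
    (hout.eq_const hα hfac) (D.continuous_component α) hτ' hM.infinite_dimensional
  exact ⟨_, D.isMatrixUnits_of_isTower hv hsum, D.isEquivariant_of_isTower B α hc hv hsum⟩
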